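/- All graphs are finite and simple; $d_G(u)$ is the degree of $u$ in $G$. For a graph $G$ let $\sigma_2(G)=\min\{d_G(u)+d_G(v): u,v\in V(G),\ u\ne v,\ uv\notin E(G)\}$ if $G$ is not complete, and $\sigma_2(G)=\infty$ if $G$ is complete. For an integer $k\ge 2$, a $[2,k]$-ST of $G$ is a spanning tree $T$ of $G$ in which no vertex has degree $d_T$ from $2$ to $k$; a $k$-blocking set of a connected graph $G$ is a cutset $U\subseteq V(G)$ (that is, $G-U$ is disconnected) such that $2\le d_G(u)\le k$ for every $u\in U$. Let $c_k=\sqrt{k(k-1)(k+2\sqrt{2k}+2)}$, and let $n_1(k)$ be the smallest positive integer such that $\frac{n+2k-2}{4}-2c_k\sqrt{n}-k^2-2k-1\ge 0$ for every integer $n\ge n_1(k)$. Theorem. Let $k\ge 2$ be an integer, and let $G$ be a connected graph of order $n\ge n_1(k)$ with $\sigma_2(G)\ge\frac{n+2k-2}{2}$. Then $G$ has a $[2,k]$-ST if and only if $G$ has no $k$-blocking set. -/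

import Mathlib

namespace TwoKST

open scoped Classical in
/-- `T` is a `[2,k]`-ST of `G`: a spanning tree of `G` (a tree on the whole vertex set, all of whose
edges are edges of `G`) without vertices of degree from `2` to `k` in `T`. -/
def IsTwoKST {V : Type*} [Fintype V] (G : SimpleGraph V) (k : ℕ) (T : SimpleGraph V) : Prop :=
  T ≤ G ∧ T.IsTree ∧ ∀ v : V, ¬ (2 ≤ T.degree v ∧ T.degree v ≤ k)

/-- `U` is a cutset of the (connected) graph `G`: the graph `G - U` is disconnected, i.e. it has two
vertices that no path of `G - U` joins. -/
def IsCutset {V : Type*} (G : SimpleGraph V) (U : Set V) : Prop :=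
  ¬ (G.induce Uᶜ).Preconnected

open scoped Classical in
/-- `U` is a `k`-blocking set of `G`: a cutset of `G` all of whose vertices have degree between
`2` and `k` in `G`. -/
def IsBlockingSet {V : Type*} [Fintype V] (G : SimpleGraph V) (k : ℕ) (U : Set V) : Prop :=
  IsCutset G U ∧ ∀ u ∈ U, 2 ≤ G.degree u ∧ G.degree u ≤ k

open scoped Classical in
/-- `σ₂(G)`: the minimum of `d(u) + d(v)` over all pairs of distinct non-adjacent vertices;
it is `∞` if `G` is complete (the infimum over no pair). -/
noncomputable def sigma2 {V : Type*} [Fintype V] (G : SimpleGraph V) : ℕ∞ :=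
  ⨅ (u : V) (v : V) (_ : u ≠ v ∧ ¬ G.Adj u v), ((G.degree u + G.degree v : ℕ) : ℕ∞)

/-- `c_k = √(k (k - 1) (k + 2 √(2k) + 2))`. -/
noncomputable def c (k : ℕ) : ℝ :=
  √((k : ℝ) * ((k : ℝ) - 1) * ((k : ℝ) + 2 * √(2 * (k : ℝ)) + 2))

/-- The positive integers `N` such that
`(n + 2k - 2) / 4 - 2 c_k √n - k² - 2k - 1 ≥ 0` for every integer `n ≥ N`. -/
def n1Set (k : ℕ) : Set ℕ :=
  {N : ℕ | 1 ≤ N ∧ ∀ n : ℕ, N ≤ n →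
    0 ≤ ((n : ℝ) + 2 * (k : ℝ) - 2) / 4 - 2 * c k * √(n : ℝ) - (k : ℝ) ^ 2 - 2 * (k : ℝ) - 1}

/-- `n₁(k)`: the smallest element of `n1Set k`. -/
noncomputable def n1 (k : ℕ) : ℕ := sInf (n1Set k)

/-- The set of which `n₁(k)` is the minimum is non-empty, so `n₁(k)` is not a junk value. -/
theorem n1Set_nonempty (k : ℕ) : (n1Set k).Nonempty := by
  have hc : 0 ≤ c k := Real.sqrt_nonneg _
  have hk : (0 : ℝ) ≤ (k : ℝ) := Nat.cast_nonneg k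
  obtain ⟨N, hN⟩ := exists_nat_ge ((8 * c k + 4 * ((k : ℝ) ^ 2 + 2 * k + 1) + 2) ^ 2)
  refine ⟨N + 1, by omega, fun n hn => ?_⟩
  have hn' : (N : ℝ) ≤ (n : ℝ) := by exact_mod_cast (by omega : N ≤ n)
  have hs : 8 * c k + 4 * ((k : ℝ) ^ 2 + 2 * k + 1) + 2 ≤ √(n : ℝ) :=
    Real.le_sqrt_of_sq_le (hN.trans hn')
  have hq : √(n : ℝ) * √(n : ℝ) = n := Real.mul_self_sqrt (Nat.cast_nonneg n)
  have hM : (0 : ℝ) ≤ 4 * ((k : ℝ) ^ 2 + 2 * k + 1) + 2 := by positivity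
  have h1 : (1 : ℝ) ≤ √(n : ℝ) := by nlinarith [sq_nonneg (k : ℝ)]
  have h2 := mul_le_mul_of_nonneg_right hs (Real.sqrt_nonneg (n : ℝ))
  have h3 := mul_le_mul_of_nonneg_left h1 hM
  nlinarith

/-- `n₁(k)` is the smallest element of `n1Set k`. -/
theorem isLeast_n1 (k : ℕ) : IsLeast (n1Set k) (n1 k) :=
  ⟨Nat.sInf_mem (n1Set_nonempty k), fun _ h => Nat.sInf_le h⟩

end TwoKST

/-! ### Spanning trees from parent functions and from connected dominating cores. -/

namespace TwoKST

open Finset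
open scoped Classical

variable {V : Type*}

/-! Necessity: a vertex of degree at most `k` in `G` has degree at most 1 in a `[2,k]`-ST, and
deleting leaves keeps a tree connected, so no set of such vertices is a cutset.

Sufficiency rests on a small connected dominating set `K`. Take a spanning tree with root in `K`
whose vertices outside `K` are leaves; it suffices that every vertex of `K` has `k` children and the
root `k + 1`. Hall's theorem provides private leaves outside `K` once degrees on `K` are about `(k +
1)|K|`; a few poorer vertices are harmless, since a family of poor vertices needs few leaves
(`exists_isTwoKST_of_core`). To find `K`, choose `m = O(k)` vertices greedily, cover the at most `r`
vertices left over by neighbours already dominated (`exists_cover`), and join the pieces at the cost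
of two vertices each (`exists_merge`). This gives `|K| ≤ 3m + r + 1`, with `(k + 1) r` a small
fraction of `n`.

Let `d` be the minimum degree, attained at `x`, and `W` the set of vertices other than `x` not
adjacent to `x`; degrees on `W` are at least about `n/2 - d`. If `d ≥ n/7`, all degrees suffice. If
`n/10 ≤ d < n/7`, cover and merge inside `W`: at most three pieces remain, so `K` has at most seven
vertices outside `W`. If `d < n/10`, the vertices of degree below `(n + 2k - 2)/4` form a clique
`L`, and `G - L` has at most two components. Unless a blocking set lies inside `L`, the tree is
rooted at a vertex of `L` that joins everything, or at one of two adjacent vertices of `L` that each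
join one component, or all of `L` can be leaves. -/

/-- The graph on all of `V` whose edges are the edges of `G` inside `C`. -/
def inside (G : SimpleGraph V) (C : Finset V) : SimpleGraph V where
  Adj u v := G.Adj u v ∧ u ∈ C ∧ v ∈ C
  symm := ⟨fun _ _ h => ⟨h.1.symm, h.2.2, h.2.1⟩⟩
  loopless := ⟨fun _ h => G.loopless.irrefl _ h.1⟩

theorem inside_mono {G : SimpleGraph V} {C D : Finset V} (h : C ⊆ D) : inside G C ≤ inside G D :=
  fun _ _ huv => ⟨huv.1, h huv.2.1, h huv.2.2⟩

/-- The vertices of `A` adjacent to `v`. -/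
noncomputable def nbr (G : SimpleGraph V) (A : Finset V) (v : V) : Finset V :=
  A.filter (G.Adj v)

theorem mem_nbr {G : SimpleGraph V} {A : Finset V} {v w : V} :
    w ∈ nbr G A v ↔ w ∈ A ∧ G.Adj v w := by
  simp [nbr]

theorem exists_adj_dist_lt {G : SimpleGraph V} {u v : V} (h : G.Reachable u v) (hne : v ≠ u) :
    ∃ w, G.Adj v w ∧ G.dist u w < G.dist u v := by
  obtain ⟨p, hp⟩ := h.symm.exists_walk_length_eq_dist
  cases p with
  | nil => exact absurd rfl hne
  | cons hadj q =>
    refine ⟨_, hadj, ?_⟩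
    rw [SimpleGraph.dist_comm, SimpleGraph.dist_comm (u := u), ← hp]
    have := SimpleGraph.dist_le q
    simp only [SimpleGraph.Walk.length_cons]
    omega

variable [Fintype V]

theorem degree_eq_card_nbr (G : SimpleGraph V) (v : V) [Fintype (G.neighborSet v)] :
    G.degree v = (nbr G univ v).card := by
  rw [← SimpleGraph.card_neighborFinset_eq_degree]
  congr 1
  ext w
  simp [mem_nbr]

/-- A graph with a `[2,k]`-spanning tree has no `k`-blocking set. -/
theorem IsTwoKST.not_isBlockingSet {G T : SimpleGraph V} {k : ℕ} (hT : IsTwoKST G k T)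
    (U : Set V) : ¬ IsBlockingSet G k U := by
  rintro ⟨hcut, hU⟩
  obtain ⟨hle, htree, hdeg⟩ := hT
  have hleaf : ∀ u ∈ U, ∀ a b, T.Adj u a → T.Adj u b → a = b := by
    intro u hu a b ha hb
    by_contra hab
    have h1 : T.degree u ≤ G.degree u := by
      rw [degree_eq_card_nbr, degree_eq_card_nbr]
      exact card_le_card fun w hw => mem_nbr.2 ⟨mem_univ _, hle (mem_nbr.1 hw).2⟩
    have h2 : 2 ≤ T.degree u := by
      rw [degree_eq_card_nbr, ← card_pair hab]
      apply card_le_card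
      intro w hw
      rcases mem_insert.1 hw with rfl | hw
      · exact mem_nbr.2 ⟨mem_univ _, ha⟩
      · rw [mem_singleton.1 hw]
        exact mem_nbr.2 ⟨mem_univ _, hb⟩
    exact hdeg u ⟨h2, h1.trans (hU u hu).2⟩
  apply hcut
  rintro ⟨a, ha⟩ ⟨b, hb⟩
  have key : ∀ m : ℕ, ∀ b (hb : b ∈ Uᶜ), T.dist a b = m →
      (G.induce Uᶜ).Reachable ⟨a, ha⟩ ⟨b, hb⟩ := by
    intro m
    induction m using Nat.strong_induction_on with
    | _ m ih =>
      intro b hb hm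
      by_cases hba : b = a
      · subst hba; rfl
      obtain ⟨c, hbc, hlt⟩ := exists_adj_dist_lt (htree.1.preconnected a b) hba
      -- If `c ∈ U`, its only `T`-neighbour would be `b`, which is farther from `a` than `c`.
      have hcU : c ∈ Uᶜ := by
        intro hcU
        have hca : c ≠ a := fun h => ha (h ▸ hcU)
        obtain ⟨e, hce, hlt'⟩ := exists_adj_dist_lt (htree.1.preconnected a c) hca
        have := hleaf c hcU b e hbc.symm hce
        subst this
        omega
      have h1 := ih _ (hm ▸ hlt) c hcU rfl
      exact h1.trans (SimpleGraph.Adj.reachable (by simpa using (hle hbc).symm))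
  exact key _ b hb rfl

/-- A parent function along which a height decreases defines a spanning tree, which is a
`[2,k]`-spanning tree if each vertex has no child or many children. -/
theorem exists_isTwoKST_of_parent {G : SimpleGraph V} {k : ℕ} (p : V → V) (r : V) (ht : V → ℕ)
    (hadj : ∀ v, v ≠ r → G.Adj v (p v)) (hlt : ∀ v, v ≠ r → ht (p v) < ht v)
    (hch : ∀ z, z ≠ r → (∀ v, v ≠ r → p v ≠ z) ∨
      k ≤ (univ.filter fun v => v ≠ r ∧ p v = z).card)
    (hr : k + 1 ≤ (univ.filter fun v => v ≠ r ∧ p v = r).card) :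
    ∃ T, IsTwoKST G k T := by
  let T : SimpleGraph V :=
    { Adj := fun u v => (u ≠ r ∧ p u = v) ∨ (v ≠ r ∧ p v = u)
      symm := ⟨fun _ _ h => h.symm⟩
      loopless := ⟨fun v h => by
        have : v ≠ r ∧ p v = v := by tauto
        have h1 := hlt v this.1
        rw [this.2] at h1
        exact lt_irrefl _ h1⟩ }
  have hTp : ∀ v, v ≠ r → T.Adj v (p v) := fun v hv => Or.inl ⟨hv, rfl⟩
  have hreach : ∀ m v, ht v = m → T.Reachable r v := by
    intro m
    induction m using Nat.strong_induction_on with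
    | _ m ih =>
      intro v hv
      by_cases hvr : v = r
      · rw [hvr]
      · exact (ih _ (hv ▸ hlt v hvr) _ rfl).trans (hTp v hvr).symm.reachable
  have hconn : T.Connected := by
    have : Nonempty V := ⟨r⟩
    exact ⟨fun u v => (hreach _ u rfl).symm.trans (hreach _ v rfl)⟩
  refine ⟨T, ?_, ?_, ?_⟩
  · rintro u v (⟨h, rfl⟩ | ⟨h, rfl⟩)
    · exact hadj u h
    · exact (hadj v h).symm
  · rw [SimpleGraph.isTree_iff_connected_and_card]
    refine ⟨hconn, le_antisymm ?_ hconn.card_vert_le_card_edgeSet_add_one⟩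
    have h1 : T.edgeSet ⊆ ((univ.erase r).image fun v => s(v, p v) : Finset (Sym2 V)) := by
      intro e
      induction e using Sym2.ind with
      | _ u v =>
        intro huv
        have huv' : (u ≠ r ∧ p u = v) ∨ (v ≠ r ∧ p v = u) := huv
        rcases huv' with ⟨h, h'⟩ | ⟨h, h'⟩
        · exact mem_coe.2 (mem_image.2 ⟨u, mem_erase.2 ⟨h, mem_univ _⟩, by rw [h']⟩)
        · exact mem_coe.2 (mem_image.2 ⟨v, mem_erase.2 ⟨h, mem_univ _⟩, by rw [h', Sym2.eq_swap]⟩)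
    have h2 : Nat.card T.edgeSet ≤ (univ.erase r).card := by
      rw [Nat.card_coe_set_eq]
      refine (Set.ncard_le_ncard h1 (Finset.finite_toSet _)).trans ?_
      rw [Set.ncard_coe_finset]
      exact card_image_le
    have h3 := card_erase_add_one (mem_univ r)
    rw [Nat.card_eq_fintype_card (α := V), ← card_univ]
    omega
  · intro z
    rw [degree_eq_card_nbr]
    by_cases hzr : z = r
    · subst hzr
      have : (univ.filter fun v => v ≠ z ∧ p v = z).card ≤ (nbr T univ z).card := by
        apply card_le_card
        intro v hv
        simp only [mem_filter, mem_univ, true_and] at hv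
        exact mem_nbr.2 ⟨mem_univ _, Or.inr hv⟩
      omega
    rcases hch z hzr with h | h
    · have : nbr T univ z ⊆ {p z} := by
        intro v hv
        rcases (mem_nbr.1 hv).2 with ⟨_, h1⟩ | ⟨h1, h2⟩
        · simp [h1]
        · exact absurd h2 (h v h1)
      have := card_le_card this
      simp only [card_singleton] at this
      omega
    -- The parent of `z` is lower than `z`, hence not a child: with `k` children the degree is at
    -- least `k + 1`.
    · have hnot : p z ∉ univ.filter fun v => v ≠ r ∧ p v = z := by
        simp only [mem_filter, mem_univ, true_and]
        rintro ⟨h1, h2⟩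
        have h3 := hlt _ h1
        have h4 := hlt _ hzr
        rw [h2] at h3
        omega
      have : insert (p z) (univ.filter fun v => v ≠ r ∧ p v = z) ⊆ nbr T univ z := by
        intro v hv
        rcases mem_insert.1 hv with rfl | hv
        · exact mem_nbr.2 ⟨mem_univ _, hTp z hzr⟩
        · simp only [mem_filter, mem_univ, true_and] at hv
          exact mem_nbr.2 ⟨mem_univ _, Or.inr hv⟩
      have := card_le_card this
      rw [card_insert_of_notMem hnot] at this
      omega

theorem card_nbr_sdiff_ge (G : SimpleGraph V) (c : V) (C Y : Finset V) :
    (nbr G univ c).card ≤ (nbr G univ c \ (C ∪ Y)).card + C.card + Y.card := by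
  have h1 := le_card_sdiff (C ∪ Y) (nbr G univ c)
  have h2 := card_union_le C Y
  omega

/-- A connected dominating set `C` whose vertices can be given enough private leaves extends to a
`[2,k]`-spanning tree. The leaves `Y` are attached beforehand by `g`; the vertices outside `Q` have
enough children already. -/
theorem exists_isTwoKST_of_core {G : SimpleGraph V} {k : ℕ} {C Y Q P : Finset V}
    {y : V} {g : V → V} (hy : y ∈ C) (hconn : ∀ v ∈ C, (inside G C).Reachable y v)
    (hdom : ∀ v, v ∉ C → ∃ c ∈ C, G.Adj v c)
    (hY : ∀ v ∈ Y, v ∉ C ∧ g v ∈ C ∧ G.Adj v (g v))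
    (hQC : Q ⊆ C)
    (hrich : ∀ c ∈ Q, c ∉ P → k * Q.card + C.card + Y.card ≤ (nbr G univ c).card)
    (hpoor : ∀ c ∈ P, k * P.card + C.card + Y.card ≤ (nbr G univ c).card)
    (htwo : y ∈ Q → 2 ≤ C.card)
    (hspec : ∀ p : V → V,
      (∀ v ∈ C, v ≠ y → p v ∈ C ∧ G.Adj v (p v) ∧
        (inside G C).dist y (p v) < (inside G C).dist y v) →
      (∀ v ∈ Y, p v = g v) → ∀ z ∈ C, z ∉ Q →
      (if z = y then k + 1 else k) ≤ (univ.filter fun v => v ≠ y ∧ p v = z).card) :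
    ∃ T, IsTwoKST G k T := by
  -- Each vertex of `Q` enters Hall's theorem in `k` copies, each asking for its own leaf outside `C
  -- ∪ Y`.
  let t : {c // c ∈ Q} × Fin k → Finset V := fun i => nbr G univ i.1.1 \ (C ∪ Y)
  have hall : ∀ s : Finset ({c // c ∈ Q} × Fin k), s.card ≤ (s.biUnion t).card := by
    intro s
    -- A single copy of a vertex outside `P` sees enough free vertices for all `k|Q|` copies; a
    -- family of copies from `P` alone has at most `k|P|` members.
    by_cases hs : ∃ i ∈ s, i.1.1 ∉ P
    · obtain ⟨i, his, hiP⟩ := hs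
      have h1 : s.card ≤ Q.card * k := by
        refine (card_le_univ s).trans ?_
        simp
      have h2 := hrich _ i.1.2 hiP
      have h3 := card_nbr_sdiff_ge G i.1.1 C Y
      have h4 : (t i).card ≤ (s.biUnion t).card := card_le_card (subset_biUnion_of_mem t his)
      have h5 : (t i).card = (nbr G univ i.1.1 \ (C ∪ Y)).card := rfl
      rw [mul_comm] at h1
      omega
    · push Not at hs
      rcases s.eq_empty_or_nonempty with rfl | ⟨i, his⟩
      · simp
      have h1 : s.card ≤ P.card * k := by
        have : s.card ≤ (P ×ˢ (univ : Finset (Fin k))).card := by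
          refine card_le_card_of_injOn (fun j => (j.1.1, j.2)) ?_ ?_
          · intro j hj
            simpa using hs j hj
          · intro a _ b _ hab
            simp only [Prod.mk.injEq] at hab
            exact Prod.ext (Subtype.ext hab.1) hab.2
        simpa using this
      have h2 := hpoor _ (hs i his)
      have h3 := card_nbr_sdiff_ge G i.1.1 C Y
      have h4 : (t i).card ≤ (s.biUnion t).card := card_le_card (subset_biUnion_of_mem t his)
      have h5 : (t i).card = (nbr G univ i.1.1 \ (C ∪ Y)).card := rfl
      rw [mul_comm] at h1
      omega
  obtain ⟨f, hfinj, hft⟩ := (all_card_le_biUnion_card_iff_exists_injective t).1 hall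
  have hf : ∀ i, f i ∉ C ∧ f i ∉ Y ∧ G.Adj i.1.1 (f i) := by
    intro i
    have := hft i
    simp only [t, mem_sdiff, mem_union, mem_nbr, mem_univ, true_and, not_or] at this
    tauto
  have hpar : ∀ v, ∃ u, v ≠ y → u ∈ C ∧ G.Adj v u ∧
      (v ∈ C → (inside G C).dist y u < (inside G C).dist y v) ∧
      (v ∈ Y → u = g v) ∧ (∀ i, f i = v → u = i.1.1) := by
    intro v
    by_cases hvC : v ∈ C
    · by_cases hvy : v = y
      · exact ⟨y, fun h => absurd hvy h⟩
      obtain ⟨w, hw, hlt⟩ := exists_adj_dist_lt (hconn v hvC) hvy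
      exact ⟨w, fun _ => ⟨hw.2.2, hw.1, fun _ => hlt, fun h => absurd hvC (hY v h).1,
        fun i hi => absurd hvC (hi ▸ (hf i).1)⟩⟩
    by_cases hvY : v ∈ Y
    · exact ⟨g v, fun _ => ⟨(hY v hvY).2.1, (hY v hvY).2.2, fun h => absurd h hvC, fun _ => rfl,
        fun i hi => absurd hvY (hi ▸ (hf i).2.1)⟩⟩
    by_cases hvf : ∃ i, f i = v
    · obtain ⟨i, rfl⟩ := hvf
      exact ⟨i.1.1, fun _ => ⟨hQC i.1.2, (hf i).2.2.symm, fun h => absurd h hvC,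
        fun h => absurd h hvY, fun j hj => by rw [hfinj hj]⟩⟩
    · obtain ⟨c, hc, hvc⟩ := hdom v hvC
      exact ⟨c, fun _ => ⟨hc, hvc, fun h => absurd h hvC, fun h => absurd h hvY,
        fun i hi => absurd ⟨i, hi⟩ hvf⟩⟩
  choose p hp using hpar
  have hYy : ∀ v ∈ Y, v ≠ y := fun v hv h => (hY v hv).1 (h ▸ hy)
  have hspec' := hspec p (fun v hv hvy => ⟨(hp v hvy).1, (hp v hvy).2.1, (hp v hvy).2.2.1 hv⟩)
    (fun v hv => (hp v (hYy v hv)).2.2.2.1 hv)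
  have hQch : ∀ z ∈ Q, k ≤ (univ.filter fun v => v ∉ C ∧ v ≠ y ∧ p v = z).card := by
    intro z hz
    have : (univ : Finset (Fin k)).card ≤
        (univ.filter fun v => v ∉ C ∧ v ≠ y ∧ p v = z).card := by
      refine card_le_card_of_injOn (fun j => f (⟨z, hz⟩, j)) ?_ ?_
      · intro j _
        have h1 := hf (⟨z, hz⟩, j)
        have h2 : f (⟨z, hz⟩, j) ≠ y := fun h => h1.1 (h ▸ hy)
        simpa using ⟨h1.1, h2, (hp _ h2).2.2.2.2 _ rfl⟩
      · intro a _ b _ hab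
        have := hfinj hab
        simpa using this
    simpa using this
  let M := (C.sup fun v => (inside G C).dist y v) + 1
  refine exists_isTwoKST_of_parent p y (fun v => if v ∈ C then (inside G C).dist y v else M)
    (fun v hv => (hp v hv).2.1) ?_ ?_ ?_
  · intro v hv
    have h1 := hp v hv
    simp only [h1.1, if_true]
    by_cases hvC : v ∈ C
    · simpa [hvC] using h1.2.2.1 hvC
    · simp only [hvC, if_false]
      exact Nat.lt_succ_of_le (le_sup (f := fun v => (inside G C).dist y v) h1.1)
  · intro z hzy
    by_cases hzC : z ∈ C
    · right
      by_cases hzQ : z ∈ Q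
      · refine (hQch z hzQ).trans (card_le_card ?_)
        intro v hv
        simp only [mem_filter, mem_univ, true_and] at hv ⊢
        exact hv.2
      · simpa [hzy] using hspec' z hzC hzQ
    · left
      intro v hv h
      exact hzC (h ▸ (hp v hv).1)
  · by_cases hyQ : y ∈ Q
    -- The root has no parent, so `k` private leaves are one child short. The core vertex nearest to
    -- the root supplies it, since its parent is nearer still.
    · have hne : (C.erase y).Nonempty := by
        rw [← card_pos, card_erase_of_mem hy]
        have := htwo hyQ
        omega
      obtain ⟨v, hv, hmin⟩ := exists_min_image (C.erase y) (fun v => (inside G C).dist y v) hne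
      obtain ⟨hvy, hvC⟩ := mem_erase.1 hv
      have hpv : p v = y := by
        by_contra hpv
        have h1 := hmin (p v) (mem_erase.2 ⟨hpv, (hp v hvy).1⟩)
        have h2 := (hp v hvy).2.2.1 hvC
        omega
      have h1 := hQch y hyQ
      have h2 : v ∉ univ.filter fun v => v ∉ C ∧ v ≠ y ∧ p v = y := by simp [hvC]
      have h3 : insert v (univ.filter fun v => v ∉ C ∧ v ≠ y ∧ p v = y) ⊆
          univ.filter fun v => v ≠ y ∧ p v = y := by
        intro w hw
        simp only [mem_insert, mem_filter, mem_univ, true_and] at hw ⊢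
        rcases hw with rfl | hw
        · exact ⟨hvy, hpv⟩
        · exact hw.2
      have h4 := card_le_card h3
      rw [card_insert_of_notMem h2] at h4
      omega
    · simpa using hspec' y hy hyQ

end TwoKST

/-! ### Greedy domination and merging of pieces. -/

namespace TwoKST

open Finset
open scoped Classical

variable {V : Type*}

/-- `v` lies in `S` or has a neighbour in `S`. -/
def Dominates (G : SimpleGraph V) (S : Finset V) (v : V) : Prop :=
  ∃ s ∈ S, v = s ∨ G.Adj v s

theorem Dominates.mono {G : SimpleGraph V} {S T : Finset V} {v : V} (h : Dominates G S v)
    (hST : S ⊆ T) : Dominates G T v := by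
  obtain ⟨s, hs, h⟩ := h
  exact ⟨s, hST hs, h⟩

theorem reachable_inside_of_eq_or_adj {G : SimpleGraph V} {C : Finset V} {u v : V} (hu : u ∈ C)
    (hv : v ∈ C) (h : u = v ∨ G.Adj u v) : (inside G C).Reachable u v := by
  rcases h with rfl | h
  · rfl
  · exact SimpleGraph.Adj.reachable ⟨h, hu, hv⟩

/-- A dominating set of `W` can be enlarged inside `W`, at the cost of two vertices for each piece
that disappears, until its pieces lie in different components of `W`. -/
theorem exists_merge {G : SimpleGraph V} {W : Finset V} (n : ℕ) {E S : Finset V} (hn : S.card = n)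
    (hEW : E ⊆ W) (hSE : S ⊆ E) (hdom : ∀ v ∈ W, Dominates G E v)
    (hrep : ∀ e ∈ E, ∃ s ∈ S, (inside G E).Reachable e s) :
    ∃ E' S', E ⊆ E' ∧ E' ⊆ W ∧ S' ⊆ S ∧ E'.card + 2 * S'.card ≤ E.card + 2 * S.card ∧
      (∀ e ∈ E', ∃ s ∈ S', (inside G E').Reachable e s) ∧
      ∀ s ∈ S', ∀ s' ∈ S', (inside G W).Reachable s s' → s = s' := by
  induction n generalizing E S with
  | zero =>
    exact ⟨E, S, Subset.rfl, hEW, Subset.rfl, le_rfl, hrep, fun s hs => by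
      rw [card_eq_zero.1 hn] at hs; exact absurd hs (notMem_empty _)⟩
  | succ n ih =>
    by_cases hgood : ∀ s ∈ S, ∀ s' ∈ S, (inside G W).Reachable s s' → s = s'
    · exact ⟨E, S, Subset.rfl, hEW, Subset.rfl, le_rfl, hrep, hgood⟩
    push Not at hgood
    obtain ⟨s, hs, s', hs', hreach, hne⟩ := hgood
    suffices h : ∃ E1 r, E ⊆ E1 ∧ E1 ⊆ W ∧ E1.card ≤ E.card + 2 ∧ r ∈ S ∧ r ≠ s ∧
        (inside G E1).Reachable r s ∧ ∀ e ∈ E1, ∃ t ∈ S, (inside G E1).Reachable e t by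
      obtain ⟨E1, r, h1, h2, h3, h4, h5, h6, h7⟩ := h
      have hcard := card_erase_of_mem h4
      obtain ⟨E', S', g1, g2, g3, g4, g5, g6⟩ := ih (E := E1) (S := S.erase r) (by omega) h2
        ((erase_subset _ _).trans (hSE.trans h1)) (fun v hv => (hdom v hv).mono h1) (by
          intro e he
          obtain ⟨t, ht, het⟩ := h7 e he
          by_cases htr : t = r
          · subst htr
            exact ⟨s, mem_erase.2 ⟨h5.symm, hs⟩, het.trans h6⟩
          · exact ⟨t, mem_erase.2 ⟨htr, ht⟩, het⟩)
      exact ⟨E', S', h1.trans g1, g2, g3.trans (erase_subset _ _), by omega, g5, g6⟩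
    by_cases hEs : (inside G E).Reachable s' s
    · exact ⟨E, s', Subset.rfl, hEW, by omega, hs', hne.symm, hEs, hrep⟩
    -- `X` is the closed neighbourhood of the piece of `s`. A walk in `W` from `s` to `s'` leaves it
    -- along some edge `uv`; `v` is dominated by another piece, so adding `u` and `v` merges two
    -- pieces.
    let X : Set V := {v | ∃ x, x ∈ E ∧ (inside G E).Reachable x s ∧ (v = x ∨ G.Adj v x)}
    have hsX : s ∈ X := ⟨s, hSE hs, by rfl, Or.inl rfl⟩
    have hX : ∀ e ∈ E, e ∈ X → (inside G E).Reachable e s := by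
      rintro e he ⟨x, hxE, hx, hex⟩
      exact (reachable_inside_of_eq_or_adj he hxE hex).trans hx
    obtain ⟨w⟩ := hreach
    obtain ⟨d, -, hu, hv⟩ := w.exists_boundary_dart X hsX (fun h => hEs (hX _ (hSE hs') h))
    obtain ⟨huv, huW, hvW⟩ := d.adj
    set u := d.fst
    set v := d.snd
    obtain ⟨x, hxE, hxs, hux⟩ := hu
    obtain ⟨e, heE, hve⟩ := hdom v hvW
    obtain ⟨r, hrS, her⟩ := hrep e heE
    have hrs : r ≠ s := by
      rintro rfl
      exact hv ⟨e, heE, her, hve⟩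
    let E1 := insert u (insert v E)
    have hEE1 : E ⊆ E1 := (subset_insert _ _).trans (subset_insert _ _)
    have huE1 : u ∈ E1 := mem_insert_self _ _
    have hvE1 : v ∈ E1 := mem_insert_of_mem (mem_insert_self _ _)
    have hm := inside_mono (G := G) hEE1
    have hus : (inside G E1).Reachable u s :=
      (reachable_inside_of_eq_or_adj huE1 (hEE1 hxE) hux).trans (hxs.mono hm)
    have hvs : (inside G E1).Reachable v s :=
      (reachable_inside_of_eq_or_adj hvE1 huE1 (Or.inr huv.symm)).trans hus
    have hrs' : (inside G E1).Reachable r s :=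
      ((her.mono hm).symm.trans
        (reachable_inside_of_eq_or_adj hvE1 (hEE1 heE) hve).symm).trans hvs
    refine ⟨E1, r, hEE1, ?_, ?_, hrS, hrs, hrs', ?_⟩
    · intro z hz
      rcases mem_insert.1 hz with rfl | hz
      · exact huW
      rcases mem_insert.1 hz with rfl | hz
      · exact hvW
      · exact hEW hz
    · have h1 := card_insert_le u (insert v E)
      have h2 := card_insert_le v E
      change (insert u (insert v E)).card ≤ _
      omega
    · intro z hz
      rcases mem_insert.1 hz with rfl | hz
      · exact ⟨s, hs, hus⟩
      rcases mem_insert.1 hz with rfl | hz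
      · exact ⟨s, hs, hvs⟩
      · obtain ⟨t, ht, hzt⟩ := hrep z hz
        exact ⟨t, ht, hzt.mono hm⟩

/-- For connected `W` the merging ends with exactly one piece; that piece is never paid for, which
saves 2. -/
theorem exists_connected_superset {G : SimpleGraph V} {W E S : Finset V} (hS : S.Nonempty)
    (hEW : E ⊆ W) (hSE : S ⊆ E) (hdom : ∀ v ∈ W, Dominates G E v)
    (hrep : ∀ e ∈ E, ∃ s ∈ S, (inside G E).Reachable e s)
    (hW : ∀ a ∈ W, ∀ b ∈ W, (inside G W).Reachable a b) :
    ∃ K, E ⊆ K ∧ K ⊆ W ∧ K.card + 2 ≤ E.card + 2 * S.card ∧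
      ∀ a ∈ K, ∀ b ∈ K, (inside G K).Reachable a b := by
  obtain ⟨K, S', h1, h2, h3, h4, h5, h6⟩ := exists_merge _ rfl hEW hSE hdom hrep
  obtain ⟨s₀, hs₀⟩ := hS
  obtain ⟨s, hs, -⟩ := h5 s₀ (h1 (hSE hs₀))
  have huniq : ∀ t ∈ S', t = s := fun t ht =>
    h6 t ht s hs (hW _ (hEW (hSE (h3 ht))) _ (hEW (hSE (h3 hs))))
  refine ⟨K, h1, h2, ?_, ?_⟩
  · have := card_pos.2 ⟨s, hs⟩
    omega
  · intro a ha b hb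
    obtain ⟨t, ht, hat⟩ := h5 a ha
    obtain ⟨t', ht', hbt⟩ := h5 b hb
    rw [huniq t ht] at hat
    rw [huniq t' ht'] at hbt
    exact hat.trans hbt.symm

/-- Double counting of the adjacencies between `R` and `P`: the best vertex of `P` reaches at least
the average. -/
theorem exists_nbr_card_ge {G : SimpleGraph V} {P R : Finset V} {D : ℕ} (hP : P.Nonempty)
    (hD : ∀ a ∈ R, D ≤ (nbr G P a).card) :
    ∃ w ∈ P, R.card * D ≤ P.card * (nbr G R w).card := by
  obtain ⟨w, hw, hmax⟩ := exists_max_image P (fun w => (nbr G R w).card) hP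
  refine ⟨w, hw, ?_⟩
  have h1 : R.card * D ≤ ∑ a ∈ R, (nbr G P a).card := by
    rw [← smul_eq_mul]
    exact card_nsmul_le_sum _ _ _ hD
  have h2 : ∑ w ∈ P, (nbr G R w).card ≤ P.card * (nbr G R w).card := by
    rw [← smul_eq_mul]
    exact sum_le_card_nsmul _ _ _ hmax
  have h3 : ∑ a ∈ R, (nbr G P a).card = ∑ w ∈ P, (nbr G R w).card := by
    have := sum_card_bipartiteAbove_eq_sum_card_bipartiteBelow (s := R) (t := P) G.Adj
    simp only [bipartiteAbove, bipartiteBelow] at this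
    refine this.trans (sum_congr rfl fun w _ => ?_)
    simp only [nbr, G.adj_comm]
  omega

/-- Greedy domination: after `m` steps only the fraction `(p / q) ^ m` is not dominated. -/
theorem exists_greedy {G : SimpleGraph V} {P A : Finset V} {D p q : ℕ} (hP : P.Nonempty)
    (hD : ∀ a ∈ A, D ≤ (nbr G P a).card) (hpq : q * P.card ≤ p * P.card + q * D) (m : ℕ) :
    ∃ S ⊆ P, S.card ≤ m ∧
      (A.filter fun a => ¬ Dominates G S a).card * q ^ m ≤ p ^ m * A.card := by
  induction m with
  | zero => exact ⟨∅, empty_subset _, by simp, by simpa using card_filter_le _ _⟩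
  | succ m ih =>
    obtain ⟨S, hSP, hSm, hS⟩ := ih
    set R := A.filter fun a => ¬ Dominates G S a with hR
    obtain ⟨w, hwP, hw⟩ := exists_nbr_card_ge (G := G) (R := R) hP
      (fun a ha => hD a (mem_filter.1 ha).1)
    refine ⟨insert w S, insert_subset hwP hSP, (card_insert_le _ _).trans (by omega), ?_⟩
    set R' := A.filter fun a => ¬ Dominates G (insert w S) a with hR'
    have h1 : R'.card + (nbr G R w).card ≤ R.card := by
      rw [← card_union_of_disjoint]
      · apply card_le_card
        intro a ha
        rcases mem_union.1 ha with ha | ha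
        · simp only [hR', mem_filter] at ha
          exact mem_filter.2 ⟨ha.1, fun h => ha.2 (h.mono (subset_insert _ _))⟩
        · exact (mem_nbr.1 ha).1
      · rw [disjoint_left]
        intro a ha ha'
        exact (mem_filter.1 ha).2 ⟨w, mem_insert_self _ _, Or.inr (mem_nbr.1 ha').2.symm⟩
    have hPpos := card_pos.2 hP
    -- `hpq` is `1 - D/|P| ≤ p/q` without denominators.
    have h2 : q * R'.card ≤ p * R.card := by
      refine Nat.le_of_mul_le_mul_left ?_ hPpos
      have h3 := Nat.mul_le_mul_left R.card hpq
      have h4 := Nat.mul_le_mul_left (q * P.card) h1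
      have h5 := Nat.mul_le_mul_left q hw
      nlinarith
    calc R'.card * q ^ (m + 1) = (q * R'.card) * q ^ m := by ring
      _ ≤ (p * R.card) * q ^ m := Nat.mul_le_mul_right _ h2
      _ = p * (R.card * q ^ m) := by ring
      _ ≤ p * (p ^ m * A.card) := Nat.mul_le_mul_left _ hS
      _ = p ^ (m + 1) * A.card := by ring

/-- Greedy domination, completed by a neighbour of each vertex that is left over. -/
theorem exists_cover {G : SimpleGraph V} {P A S₀ : Finset V} {D p q m : ℕ} (hP : P.Nonempty)
    (hD : ∀ a ∈ A, D ≤ (nbr G P a).card) (hpq : q * P.card ≤ p * P.card + q * D)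
    (hcov : ∀ v ∈ P, v ∈ A ∨ Dominates G S₀ v) (hlt : p ^ m * A.card < D * q ^ m) :
    ∃ S ⊆ P, ∃ T ⊆ P, S.card ≤ m ∧ T.card * q ^ m ≤ p ^ m * A.card ∧
      (∀ a ∈ A, Dominates G (S ∪ T) a) ∧ ∀ t ∈ T, Dominates G (S ∪ S₀) t := by
  obtain ⟨S, hSP, hSm, hS⟩ := exists_greedy hP hD hpq m
  set R := A.filter fun a => ¬ Dominates G S a with hR
  -- Each leftover vertex thus has a neighbour in `P` outside `R`, already dominated by `S` or `S₀`;
  -- covering `R` by such neighbours creates no new piece.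
  have hRD : R.card < D := lt_of_mul_lt_mul_right (hS.trans_lt hlt) (Nat.zero_le _)
  have hex : ∀ r, ∃ t, r ∈ R → t ∈ P ∧ G.Adj r t ∧ t ∉ R := by
    intro r
    by_cases hr : r ∈ R
    · obtain ⟨t, ht, htR⟩ := exists_mem_notMem_of_card_lt_card
        (hRD.trans_le (hD r (mem_filter.1 hr).1))
      exact ⟨t, fun _ => ⟨(mem_nbr.1 ht).1, (mem_nbr.1 ht).2, htR⟩⟩
    · exact ⟨r, fun h => absurd h hr⟩
  choose f hf using hex
  refine ⟨S, hSP, R.image f, ?_, hSm, ?_, ?_, ?_⟩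
  · intro t ht
    obtain ⟨r, hr, rfl⟩ := mem_image.1 ht
    exact (hf r hr).1
  · exact (Nat.mul_le_mul_right _ card_image_le).trans hS
  · intro a ha
    by_cases haS : Dominates G S a
    · exact haS.mono subset_union_left
    · have haR : a ∈ R := mem_filter.2 ⟨ha, haS⟩
      exact ⟨f a, mem_union_right _ (mem_image_of_mem f haR), Or.inr (hf a haR).2.1⟩
  · intro t ht
    obtain ⟨r, hr, rfl⟩ := mem_image.1 ht
    obtain ⟨h1, -, h3⟩ := hf r hr
    rcases hcov _ h1 with h | h
    · have : Dominates G S (f r) := by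
        by_contra h'
        exact h3 (mem_filter.2 ⟨h, h'⟩)
      exact this.mono subset_union_left
    · exact h.mono subset_union_right

end TwoKST

/-! ### Trees when no degree is very small. -/

namespace TwoKST

open Finset
open scoped Classical

variable {V : Type*}

theorem reachable_inside_univ [Fintype V] {G : SimpleGraph V} (hG : G.Connected) (a b : V) :
    (inside G univ).Reachable a b :=
  (hG.preconnected a b).mono fun _ _ h => ⟨h, mem_univ _, mem_univ _⟩

theorem reachable_cover {G : SimpleGraph V} {S T E : Finset V} (hST : S ∪ T ⊆ E)
    (hT : ∀ t ∈ T, Dominates G S t) {e : V} (he : e ∈ E) (hdom : Dominates G (S ∪ T) e) :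
    ∃ s ∈ S, (inside G E).Reachable e s := by
  obtain ⟨f, hf, hef⟩ := hdom
  have h1 := reachable_inside_of_eq_or_adj he (hST hf) hef
  rcases mem_union.1 hf with hfS | hfT
  · exact ⟨f, hfS, h1⟩
  · obtain ⟨s, hs, hfs⟩ := hT f hfT
    exact ⟨s, hs, h1.trans
      (reachable_inside_of_eq_or_adj (hST hf) (hST (mem_union_left _ hs)) hfs)⟩

/-- Closed neighbourhoods in `W` of vertices in different components are disjoint. This bounds the
number of pieces left after merging. -/
theorem card_mul_le_of_not_reachable {G : SimpleGraph V} {W S : Finset V} {D : ℕ} (hSW : S ⊆ W)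
    (hS : ∀ s ∈ S, ∀ s' ∈ S, (inside G W).Reachable s s' → s = s')
    (hD : ∀ w ∈ W, D ≤ (nbr G W w).card) : S.card * (D + 1) ≤ W.card := by
  have hreach : ∀ s ∈ S, ∀ v ∈ insert s (nbr G W s), (inside G W).Reachable s v := by
    intro s hs v hv
    rcases mem_insert.1 hv with rfl | hv
    · rfl
    · exact reachable_inside_of_eq_or_adj (hSW hs) (mem_nbr.1 hv).1 (Or.inr (mem_nbr.1 hv).2)
  have hdisj : ∀ s ∈ S, ∀ s' ∈ S, s ≠ s' →
      Disjoint (insert s (nbr G W s)) (insert s' (nbr G W s')) := by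
    intro s hs s' hs' hne
    rw [disjoint_left]
    intro v hv hv'
    exact hne (hS s hs s' hs' ((hreach s hs v hv).trans (hreach s' hs' v hv').symm))
  calc S.card * (D + 1) = ∑ s ∈ S, (D + 1) := by simp
    _ ≤ ∑ s ∈ S, (insert s (nbr G W s)).card := by
      refine sum_le_sum fun s hs => ?_
      rw [card_insert_of_notMem fun h => G.loopless.irrefl _ (mem_nbr.1 h).2]
      exact Nat.succ_le_succ (hD s (hSW hs))
    _ = (S.biUnion fun s => insert s (nbr G W s)).card := (card_biUnion hdisj).symm
    _ ≤ W.card := card_le_card fun v hv => by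
      obtain ⟨s, hs, hv⟩ := mem_biUnion.1 hv
      rcases mem_insert.1 hv with rfl | hv
      · exact hSW hs
      · exact (mem_nbr.1 hv).1

theorem card_union_le_of_le {A B : Finset V} {a b : ℕ} (hA : A.card ≤ a) (hB : B.card ≤ b) :
    (A ∪ B).card ≤ a + b :=
  (card_union_le _ _).trans (add_le_add hA hB)

theorem exists_adj_of_dominates {G : SimpleGraph V} {E K : Finset V} (hEK : E ⊆ K) {v : V}
    (hv : v ∉ K) (h : Dominates G E v) : ∃ c ∈ K, G.Adj v c := by
  obtain ⟨e, he, rfl | hve⟩ := h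
  · exact absurd (hEK he) hv
  · exact ⟨e, hEK he, hve⟩

variable [Fintype V]

/-- The vertices that are neither `x` nor adjacent to `x`. -/
noncomputable def far (G : SimpleGraph V) (x : V) : Finset V :=
  univ.filter fun v => v ≠ x ∧ ¬ G.Adj x v

theorem mem_far {G : SimpleGraph V} {x v : V} : v ∈ far G x ↔ v ≠ x ∧ ¬ G.Adj x v := by
  simp [far]

theorem dominates_of_notMem_far {G : SimpleGraph V} {x v : V} (h : v ∉ far G x) :
    Dominates G {x} v := by
  rw [mem_far] at h
  refine ⟨x, mem_singleton_self _, ?_⟩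
  by_cases hv : v = x
  · exact Or.inl hv
  · right
    by_contra h'
    exact h ⟨hv, fun h'' => h' h''.symm⟩

theorem two_le_card_of_far {G : SimpleGraph V} {x : V} {K E : Finset V} (hEK : E ⊆ K) (hxK : x ∈ K)
    (hW : (far G x).Nonempty) (hdom : ∀ w ∈ far G x, Dominates G E w) : 2 ≤ K.card := by
  obtain ⟨w, hw⟩ := hW
  obtain ⟨e, he, hwe⟩ := hdom w hw
  rw [mem_far] at hw
  have hex : e ≠ x := by
    rintro rfl
    rcases hwe with h | h
    · exact hw.1 h
    · exact hw.2 h.symm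
  rw [← card_pair hex]
  exact card_le_card (insert_subset (hEK he) (singleton_subset_iff.2 hxK))

/-- The case in which all degrees are large. -/
theorem exists_isTwoKST_of_minDegree {G : SimpleGraph V} (hG : G.Connected) {k : ℕ} {x : V}
    {d D p q m r : ℕ} (hd : ∀ v, d ≤ (nbr G univ v).card) (hW : (far G x).Nonempty)
    (hD : ∀ w ∈ far G x, D ≤ (nbr G univ w).card)
    (hpq : q * Fintype.card V ≤ p * Fintype.card V + q * D)
    (hlt : p ^ m * Fintype.card V < D * q ^ m)
    (hr : ∀ t, t * q ^ m ≤ p ^ m * Fintype.card V → t ≤ r)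
    (hnum : k * (3 * m + r + 1) + (3 * m + r + 1) ≤ d) : ∃ T, IsTwoKST G k T := by
  have hWn : (far G x).card ≤ Fintype.card V := card_le_univ _
  have hWn' : p ^ m * (far G x).card ≤ p ^ m * Fintype.card V := Nat.mul_le_mul_left _ hWn
  obtain ⟨S, -, T, -, hSm, hTr, hdom, hT⟩ := exists_cover (G := G) (P := univ) (A := far G x)
    (S₀ := {x}) (D := D) (p := p) (q := q) (m := m) ⟨x, mem_univ _⟩ hD (by simpa using hpq)
    (fun v _ => by
      by_cases h : v ∈ far G x
      · exact Or.inl h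
      · exact Or.inr (dominates_of_notMem_far h)) (hWn'.trans_lt hlt)
  have hTr' := hr _ (hTr.trans hWn')
  let S₁ := S ∪ {x}
  have hS₁ : S₁.card ≤ m + 1 := card_union_le_of_le hSm (by simp)
  have hdomV : ∀ v, Dominates G (S₁ ∪ T) v := by
    intro v
    by_cases h : v ∈ far G x
    · refine (hdom v h).mono (union_subset_union_left subset_union_left)
    · refine (dominates_of_notMem_far h).mono (subset_union_right.trans subset_union_left)
  have hx₁ : x ∈ S₁ := mem_union_right _ (mem_singleton_self _)
  obtain ⟨K, hEK, -, hKcard, hK⟩ := exists_connected_superset (G := G) (W := univ)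
    (E := S₁ ∪ T) (S := S₁) ⟨x, hx₁⟩ (subset_univ _) subset_union_left (fun v _ => hdomV v)
    (fun e he => reachable_cover Subset.rfl hT he (hdomV e))
    (fun a _ b _ => reachable_inside_univ hG a b)
  have hE : (S₁ ∪ T).card ≤ m + 1 + r := card_union_le_of_le hS₁ hTr'
  have hKM : K.card ≤ 3 * m + r + 1 := by omega
  have hxK : x ∈ K := hEK (mem_union_left _ hx₁)
  refine exists_isTwoKST_of_core (C := K) (Y := ∅) (Q := K) (P := ∅) (y := x) (g := id) hxK
    (fun v hv => hK x hxK v hv) (fun v hv => exists_adj_of_dominates hEK hv (hdomV v))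
    (by simp) Subset.rfl ?_ (by simp)
    (fun _ => two_le_card_of_far hEK hxK hW fun w _ => hdomV w)
    (fun p _ _ z hz hz' => absurd hz hz')
  intro c _ _
  have h1 := hd c
  have h2 := Nat.mul_le_mul_left k hKM
  simp only [card_empty]
  omega

/-- The case in which all degrees are moderately large, and those outside the neighbourhood of `x`
are large. -/
theorem exists_isTwoKST_of_far {G : SimpleGraph V} (hG : G.Connected) {k : ℕ} {x : V}
    {d B D p q m r : ℕ} (hd : ∀ v, d ≤ (nbr G univ v).card) (hW : (far G x).Nonempty)
    (hB : ∀ w ∈ far G x, B ≤ (nbr G univ w).card)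
    (hD : ∀ w ∈ far G x, D ≤ (nbr G (far G x) w).card)
    (hD4 : (far G x).card < 4 * (D + 1))
    (hpq : q * (far G x).card ≤ p * (far G x).card + q * D)
    (hlt : p ^ m * (far G x).card < D * q ^ m)
    (hr : ∀ t, t * q ^ m ≤ p ^ m * (far G x).card → t ≤ r)
    (hrich : k * (3 * m + r + 1) + (3 * m + r + 1) ≤ B)
    (hpoor : k * 7 + (3 * m + r + 1) ≤ d) : ∃ T, IsTwoKST G k T := by
  obtain ⟨S, hSW, T, hTW, hSm, hTr, hdom, hT⟩ := exists_cover (G := G) (P := far G x)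
    (A := far G x) (S₀ := ∅) hW hD hpq (fun v hv => Or.inl hv) hlt
  rw [union_empty] at hT
  obtain ⟨E, S', hSE, hEW, hS'S, hcard, hrep, hS'⟩ := exists_merge (G := G) (W := far G x) _
    (E := S ∪ T) (S := S) rfl (union_subset hSW hTW) subset_union_left hdom
    (fun e he => reachable_cover Subset.rfl hT he (hdom e (union_subset hSW hTW he)))
  have hS'E : S' ⊆ E := hS'S.trans (subset_union_left.trans hSE)
  have hS'3 : S'.card ≤ 3 := by
    have h1 := card_mul_le_of_not_reachable (hS'E.trans hEW) hS' hD
    by_contra h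
    have h2 : 4 * (D + 1) ≤ S'.card * (D + 1) := Nat.mul_le_mul_right _ (by omega)
    omega
  have hdomV : ∀ v, Dominates G (insert x E) v := by
    intro v
    by_cases h : v ∈ far G x
    · exact (hdom v h).mono (hSE.trans (subset_insert _ _))
    · exact (dominates_of_notMem_far h).mono (singleton_subset_iff.2 (mem_insert_self _ _))
  obtain ⟨K, hEK, -, hKcard, hK⟩ := exists_connected_superset (G := G) (W := univ)
    (E := insert x E) (S := insert x S') ⟨x, mem_insert_self _ _⟩ (subset_univ _)
    (insert_subset_insert _ hS'E) (fun v _ => hdomV v) (by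
      intro e he
      rcases mem_insert.1 he with rfl | he
      · exact ⟨e, mem_insert_self _ _, by rfl⟩
      · obtain ⟨s, hs, hes⟩ := hrep e he
        exact ⟨s, mem_insert_of_mem hs, hes.mono (inside_mono (subset_insert _ _))⟩)
    (fun a _ b _ => reachable_inside_univ hG a b)
  have h1 := card_insert_le x E
  have h2 := card_insert_le x S'
  have h3 := card_union_le_of_le hSm (hr _ hTr)
  have hKM : K.card ≤ 3 * m + r + 1 := by omega
  have hEK' : E ⊆ K := (subset_insert _ _).trans hEK
  -- `E` lies in `far G x`; beyond `E`, the core has only `x` and two vertices for each of at most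
  -- three further merges.
  have hP7 : (K \ far G x).card ≤ 7 := by
    have h4 : (K \ far G x).card ≤ (K \ E).card := card_le_card (sdiff_subset_sdiff Subset.rfl hEW)
    rw [card_sdiff_of_subset hEK'] at h4
    omega
  have hxK : x ∈ K := hEK (mem_insert_self _ _)
  refine exists_isTwoKST_of_core (C := K) (Y := ∅) (Q := K) (P := K \ far G x) (y := x) (g := id)
    hxK (fun v hv => hK x hxK v hv) (fun v hv => exists_adj_of_dominates hEK hv (hdomV v))
    (by simp) Subset.rfl ?_ ?_
    (fun _ => two_le_card_of_far hEK hxK hW fun w _ => hdomV w)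
    (fun p _ _ z hz hz' => absurd hz hz')
  · intro c hc hcP
    have h5 := hB c (by simpa [hc] using hcP)
    have h6 := Nat.mul_le_mul_left k hKM
    simp only [card_empty]
    omega
  · intro c _
    have h5 := hd c
    have h6 := Nat.mul_le_mul_left k hP7
    simp only [card_empty]
    omega

end TwoKST

/-! ### Trees when the vertices of small degree form a clique `L`. -/

namespace TwoKST

open Finset
open scoped Classical

variable {V : Type*}

/-- Putting a neighbour of the root into the core forces it to be a child of the root: it is at
distance 1, so its parent is at distance 0. -/
theorem parent_eq_root {K : Finset V} {y v u : V} (hK : (inside G K).Reachable y u) (hadj : (inside G K).Adj y v)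
    (hlt : (inside G K).dist y u < (inside G K).dist y v) : u = y := by
  have h1 : (inside G K).dist y v = 1 := SimpleGraph.dist_eq_one_iff_adj.2 hadj
  rw [h1, Nat.lt_one_iff, hK.dist_eq_zero_iff] at hlt
  exact hlt.symm

/-- `S ∪ T` is a small subset of `W` that dominates all vertices outside `L`, and the degrees are
large compared with its size: at least `B₂` in `W`, and at least `B₁` outside `L`. -/
structure IsCover [Fintype V] (G : SimpleGraph V) (k m r B₁ B₂ : ℕ) (L W S T : Finset V) :
    Prop where
  notMem_of_mem : ∀ w ∈ W, w ∉ L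
  left_subset : S ⊆ W
  right_subset : T ⊆ W
  card_left : S.card ≤ m
  card_right : T.card ≤ r
  dominates : ∀ h, h ∉ L → Dominates G (S ∪ T) h
  dominates_right : ∀ t ∈ T, Dominates G S t
  le_degree : ∀ h, h ∉ L → B₁ ≤ (nbr G univ h).card
  le_degree_of_mem : ∀ w ∈ W, B₂ ≤ (nbr G univ w).card
  -- Hall's condition for at most `3m + r + 2k + 2` core vertices, at most `2m + 2k` of which lie
  -- outside `W` and need private leaves, with at most `2k` leaves attached beforehand.
  rich : k * (3 * m + r + 2 * k + 2) + (3 * m + r + 2 * k + 2) + 2 * k ≤ B₂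
  poor : k * (2 * m + 2 * k) + (3 * m + r + 2 * k + 2) + 2 * k ≤ B₁

namespace IsCover

variable [Fintype V] {G : SimpleGraph V} {k m r B₁ B₂ : ℕ} {L W S T : Finset V}

theorem union_subset (h : IsCover G k m r B₁ B₂ L W S T) : S ∪ T ⊆ W :=
  Finset.union_subset h.left_subset h.right_subset

theorem nonempty (h : IsCover G k m r B₁ B₂ L W S T) {v : V} (hv : v ∉ L) : S.Nonempty := by
  obtain ⟨e, he, -⟩ := h.dominates v hv
  rcases mem_union.1 he with he | he
  · exact ⟨e, he⟩
  · obtain ⟨s, hs, -⟩ := h.dominates_right e he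
    exact ⟨s, hs⟩

/-- A connected set `K` that contains the cover, few other vertices outside `L`, and only vertices
in `L` with enough children extends to a `[2,k]`-spanning tree. -/
theorem exists_isTwoKST (h : IsCover G k m r B₁ B₂ L W S T) {K Y Z : Finset V} {y : V} {g : V → V}
    (hy : y ∈ K) (hK : ∀ a ∈ K, ∀ b ∈ K, (inside G K).Reachable a b) (hSTK : S ∪ T ⊆ K)
    (hZK : Z ⊆ K) (hZL : Z ⊆ L) (hKL : ∀ v ∈ K, v ∈ L → v ∈ Z)
    (hcard : K.card ≤ (S ∪ T).card + 2 * m + 2 * k + Z.card) (hZ2 : Z.card ≤ 2)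
    (hYk : Y.card ≤ 2 * k) (hdomL : ∀ v ∈ L, v ∉ K → ∃ c ∈ K, G.Adj v c)
    (hY : ∀ v ∈ Y, v ∉ K ∧ g v ∈ K ∧ G.Adj v (g v))
    (htwo : 2 ≤ K.card)
    (hspec : ∀ p : V → V,
      (∀ v ∈ K, v ≠ y → p v ∈ K ∧ G.Adj v (p v) ∧
        (inside G K).dist y (p v) < (inside G K).dist y v) →
      (∀ v ∈ Y, p v = g v) → ∀ z ∈ Z,
      (if z = y then k + 1 else k) ≤ (univ.filter fun v => v ≠ y ∧ p v = z).card) :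
    ∃ T, IsTwoKST G k T := by
  have hST := card_union_le_of_le h.card_left h.card_right
  have hKM : K.card ≤ 3 * m + r + 2 * k + 2 := by omega
  have hdisj : Disjoint (S ∪ T) Z := by
    rw [disjoint_left]
    intro v hv hvZ
    exact h.notMem_of_mem v (h.union_subset hv) (hZL hvZ)
  have hP : ((K \ Z) \ W).card ≤ 2 * m + 2 * k := by
    have h1 : ((K \ Z) \ W).card ≤ (K \ ((S ∪ T) ∪ Z)).card := by
      apply card_le_card
      intro v hv
      simp only [mem_sdiff] at hv
      refine mem_sdiff.2 ⟨hv.1.1, fun hv' => ?_⟩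
      rcases mem_union.1 hv' with hv' | hv'
      · exact hv.2 (h.union_subset hv')
      · exact hv.1.2 hv'
    rw [card_sdiff_of_subset (Finset.union_subset hSTK hZK), card_union_of_disjoint hdisj] at h1
    omega
  refine exists_isTwoKST_of_core (C := K) (Y := Y) (Q := K \ Z) (P := (K \ Z) \ W) (y := y) (g := g)
    hy (fun v hv => hK y hy v hv) ?_ hY sdiff_subset ?_ ?_ (fun _ => htwo) ?_
  · intro v hv
    by_cases hvL : v ∈ L
    · exact hdomL v hvL hv
    · exact exists_adj_of_dominates hSTK hv (h.dominates v hvL)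
  · intro c hc hcP
    have h1 := h.le_degree_of_mem c (by simpa [mem_sdiff.1 hc] using hcP)
    have h2 := Nat.mul_le_mul_left k ((card_le_card (sdiff_subset (s := K) (t := Z))).trans hKM)
    have h3 := h.rich
    omega
  · intro c hc
    have hcK := (mem_sdiff.1 (mem_sdiff.1 hc).1)
    have h1 := h.le_degree c fun hcL => hcK.2 (hKL c hcK.1 hcL)
    have h2 := Nat.mul_le_mul_left k hP
    have h3 := h.poor
    omega
  · intro p hp hpY z hz hzQ
    exact hspec p hp hpY z (by simpa [hz] using hzQ)

/-- A vertex `y` of degree at least `k + 1` in the clique `L` joins everything. -/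
theorem exists_isTwoKST_of_root (h : IsCover G k m r B₁ B₂ L W S T)
    (hL : ∀ a ∈ L, ∀ b ∈ L, a ≠ b → G.Adj a b) {y : V} (hy : y ∈ L)
    (hdeg : k + 1 ≤ (nbr G univ y).card) (hk : 1 ≤ k)
    (hconn : ∀ a ∈ insert y Lᶜ, ∀ b ∈ insert y Lᶜ, (inside G (insert y Lᶜ)).Reachable a b)
    (hne : (Lᶜ).Nonempty) : ∃ T, IsTwoKST G k T := by
  obtain ⟨N, hN, hNcard⟩ := exists_subset_card_eq hdeg
  have hyN : y ∉ N := fun hyN => G.loopless.irrefl _ (mem_nbr.1 (hN hyN)).2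
  have hadjN : ∀ v ∈ N, G.Adj y v := fun v hv => (mem_nbr.1 (hN hv)).2
  obtain ⟨v₀, hv₀⟩ := hne
  rw [mem_compl] at hv₀
  obtain ⟨s₀, hs₀⟩ := h.nonempty hv₀
  -- Of the `k + 1` chosen neighbours of `y`, those outside `L` enter the core and those in `L` are
  -- attached as leaves; all become children of `y`.
  set E := insert y ((S ∪ T) ∪ (N \ L)) with hE
  have hSTE : S ∪ T ⊆ E := subset_union_left.trans (subset_insert _ _)
  have hyE : y ∈ E := mem_insert_self _ _
  have hNE : N \ L ⊆ E := subset_union_right.trans (subset_insert _ _)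
  obtain ⟨K, hEK, hKW, hKcard, hK⟩ := exists_connected_superset (G := G) (W := insert y Lᶜ) (E := E)
    (S := insert y S) ⟨y, mem_insert_self _ _⟩ (by
      apply insert_subset_insert
      intro v hv
      rw [mem_compl]
      rcases mem_union.1 hv with hv | hv
      · exact h.notMem_of_mem v (h.union_subset hv)
      · exact (mem_sdiff.1 hv).2)
    (insert_subset_insert _ (subset_union_left.trans subset_union_left)) (by
      intro v hv
      rcases mem_insert.1 hv with rfl | hv
      · exact ⟨v, hyE, Or.inl rfl⟩
      · exact (h.dominates v (mem_compl.1 hv)).mono hSTE) (by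
      intro e he
      by_cases heL : e ∈ L
      · rcases mem_insert.1 he with rfl | he
        · exact ⟨e, mem_insert_self _ _, by rfl⟩
        rcases mem_union.1 he with he | he
        · exact absurd heL (h.notMem_of_mem e (h.union_subset he))
        · exact absurd heL (mem_sdiff.1 he).2
      · obtain ⟨s, hs, hes⟩ := reachable_cover hSTE h.dominates_right he (h.dominates e heL)
        exact ⟨s, mem_insert_of_mem hs, hes⟩) hconn
  have hyK := hEK hyE
  have hsK : s₀ ∈ K := hEK (hSTE (mem_union_left _ hs₀))
  have hs₀y : s₀ ≠ y := by
    rintro rfl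
    exact h.notMem_of_mem _ (h.left_subset hs₀) hy
  have hKL : ∀ v ∈ K, v ∈ L → v = y := by
    intro v hv hvL
    rcases mem_insert.1 (hKW hv) with rfl | hv
    · rfl
    · exact absurd hvL (mem_compl.1 hv)
  have hsplit := card_inter_add_card_sdiff N L
  refine h.exists_isTwoKST (K := K) (Y := N ∩ L) (Z := {y}) (y := y) (g := fun _ => y) hyK hK
    (hSTE.trans hEK) (singleton_subset_iff.2 hyK) (singleton_subset_iff.2 hy)
    (fun v hv hvL => mem_singleton.2 (hKL v hv hvL)) ?_ (by simp) ?_ ?_ ?_ ?_ ?_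
  · have h1 := card_insert_le y S
    have h2 := card_insert_le y ((S ∪ T) ∪ (N \ L))
    have h3 := card_union_le (S ∪ T) (N \ L)
    have h4 := h.card_left
    rw [← hE] at h2
    rw [card_singleton]
    omega
  · omega
  · intro v hv hvK
    exact ⟨y, hyK, hL v hv y hy fun hvy => hvK (hvy ▸ hyK)⟩
  · intro v hv
    obtain ⟨hvN, hvL⟩ := mem_inter.1 hv
    refine ⟨fun hvK => hyN (hKL v hvK hvL ▸ hvN), hyK, (hadjN v hvN).symm⟩
  · rw [← card_pair hs₀y]
    exact card_le_card (insert_subset hsK (singleton_subset_iff.2 hyK))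
  · intro p hp hpY z hz
    obtain rfl := mem_singleton.1 hz
    simp only [if_true]
    rw [← hNcard]
    apply card_le_card
    intro v hv
    have hvz : v ≠ z := fun hvz => hyN (hvz ▸ hv)
    simp only [mem_filter, mem_univ, true_and]
    refine ⟨hvz, ?_⟩
    by_cases hvL : v ∈ L
    · exact hpY v (mem_inter.2 ⟨hv, hvL⟩)
    · have hvK := hEK (hNE (mem_sdiff.2 ⟨hv, hvL⟩))
      obtain ⟨h1, -, h3⟩ := hp v hvK hvz
      exact parent_eq_root (hK _ hyK _ h1) ⟨hadjN v hv, hyK, hvK⟩ h3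

/-- `G - L` is connected, and `L` is a small set of vertices with neighbours outside `L`. -/
theorem exists_isTwoKST_of_leaves (h : IsCover G k m r B₁ B₂ L W S T)
    (hLk : L.card ≤ k) {x : V} (hx : x ∈ L) (hxW : ∀ w ∈ W, ¬ G.Adj x w)
    (hnb : ∀ l ∈ L, ∃ v, v ∉ L ∧ G.Adj l v)
    (hconn : ∀ a ∈ Lᶜ, ∀ b ∈ Lᶜ, (inside G Lᶜ).Reachable a b) : ∃ T, IsTwoKST G k T := by
  have hnb' : ∀ l, ∃ v, l ∈ L → v ∉ L ∧ G.Adj l v := by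
    intro l
    by_cases hl : l ∈ L
    · obtain ⟨v, hv⟩ := hnb l hl
      exact ⟨v, fun _ => hv⟩
    · exact ⟨l, fun hl' => absurd hl' hl⟩
  choose f hf using hnb'
  obtain ⟨s₀, hs₀⟩ := h.nonempty (hf x hx).1
  -- At the cost of at most `k` vertices, the core dominates `L` without meeting it.
  set E := (S ∪ T) ∪ L.image f with hE
  have hSTE : S ∪ T ⊆ E := subset_union_left
  have hEL : ∀ e ∈ E, e ∉ L := by
    intro e he
    rcases mem_union.1 he with he | he
    · exact h.notMem_of_mem e (h.union_subset he)
    · obtain ⟨l, hl, rfl⟩ := mem_image.1 he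
      exact (hf l hl).1
  obtain ⟨K, hEK, hKW, hKcard, hK⟩ := exists_connected_superset (G := G) (W := Lᶜ) (E := E)
    (S := S) ⟨s₀, hs₀⟩ (fun e he => mem_compl.2 (hEL e he)) (subset_union_left.trans hSTE)
    (fun v hv => (h.dominates v (mem_compl.1 hv)).mono hSTE)
    (fun e he => reachable_cover hSTE h.dominates_right he (h.dominates e (hEL e he))) hconn
  have hsK : s₀ ∈ K := hEK (hSTE (mem_union_left _ hs₀))
  have hfK : ∀ l ∈ L, f l ∈ K := fun l hl =>
    hEK (mem_union_right _ (mem_image_of_mem f hl))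
  refine h.exists_isTwoKST (K := K) (Y := ∅) (Z := ∅) (y := s₀) (g := id) hsK hK
    (hSTE.trans hEK) (empty_subset _) (empty_subset _)
    (fun v hv hvL => absurd hvL (mem_compl.1 (hKW hv))) ?_ (by simp) (by simp) ?_ (by simp) ?_
    (by simp)
  · have h2 := card_union_le (S ∪ T) (L.image f)
    have h3 := card_image_le (s := L) (f := f)
    have h4 := h.card_left
    rw [← hE] at h2
    rw [card_empty]
    omega
  · intro v hv _
    exact ⟨f v, hfK v hv, (hf v hv).2⟩
  · have hne : f x ≠ s₀ := fun hfs =>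
      hxW s₀ (h.left_subset hs₀) (hfs ▸ (hf x hx).2)
    rw [← card_pair hne]
    exact card_le_card (insert_subset (hfK x hx) (singleton_subset_iff.2 hsK))

/-- Two adjacent vertices `y₁`, `y₂` of `L` join the two sides of `G - L`. -/
theorem exists_isTwoKST_of_pair (h : IsCover G k m r B₁ B₂ L W S T)
    (hL : ∀ a ∈ L, ∀ b ∈ L, a ≠ b → G.Adj a b) {y₁ y₂ : V} (hy₁ : y₁ ∈ L) (hy₂ : y₂ ∈ L)
    (hne : y₁ ≠ y₂) {Z₁ Z₂ Y₁ Y₂ : Finset V}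
    (hZ₁ : ∀ v ∈ Z₁, v ∉ L ∧ G.Adj y₁ v)
    (hZ₂ : ∀ v ∈ Z₂, v ∉ L ∧ G.Adj y₂ v ∧ ¬ G.Adj y₁ v ∧ ∀ c, c ∉ L → G.Adj y₁ c → ¬ G.Adj v c)
    (hY₁ : ∀ v ∈ Y₁, v ∈ L ∧ v ≠ y₁ ∧ v ≠ y₂) (hY₂ : ∀ v ∈ Y₂, v ∈ L ∧ v ≠ y₁ ∧ v ≠ y₂)
    (hY : Disjoint Y₁ Y₂) (hc₁ : Z₁.card + Y₁.card = k) (hc₂ : Z₂.card + Y₂.card = k)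
    (hconn : ∀ a ∈ insert y₁ (insert y₂ Lᶜ), ∀ b ∈ insert y₁ (insert y₂ Lᶜ),
      (inside G (insert y₁ (insert y₂ Lᶜ))).Reachable a b) : ∃ T, IsTwoKST G k T := by
  have h12 : G.Adj y₁ y₂ := hL y₁ hy₁ y₂ hy₂ hne
  set E := {y₁, y₂} ∪ ((S ∪ T) ∪ (Z₁ ∪ Z₂)) with hE
  have hSTE : S ∪ T ⊆ E := subset_union_left.trans subset_union_right
  have hyE₁ : y₁ ∈ E := mem_union_left _ (by simp)
  have hyE₂ : y₂ ∈ E := mem_union_left _ (by simp)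
  have hZE₁ : Z₁ ⊆ E := (subset_union_left.trans subset_union_right).trans subset_union_right
  have hZE₂ : Z₂ ⊆ E := (subset_union_right.trans subset_union_right).trans subset_union_right
  have hEL : ∀ e ∈ E, e = y₁ ∨ e = y₂ ∨ e ∉ L := by
    intro e he
    simp only [hE, mem_union, mem_insert, mem_singleton] at he
    rcases he with (he | he) | (he | he) | (he | he)
    · exact Or.inl he
    · exact Or.inr (Or.inl he)
    · exact Or.inr (Or.inr (h.notMem_of_mem e (h.left_subset he)))
    · exact Or.inr (Or.inr (h.notMem_of_mem e (h.right_subset he)))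
    · exact Or.inr (Or.inr (hZ₁ e he).1)
    · exact Or.inr (Or.inr (hZ₂ e he).1)
  obtain ⟨K, hEK, hKW, hKcard, hK⟩ := exists_connected_superset (G := G)
    (W := insert y₁ (insert y₂ Lᶜ)) (E := E)
    (S := insert y₁ S) ⟨y₁, mem_insert_self _ _⟩ (by
      intro e he
      simp only [mem_insert, mem_compl]
      exact hEL e he)
    (insert_subset hyE₁ (subset_union_left.trans hSTE)) (by
      intro v hv
      simp only [mem_insert, mem_compl] at hv
      rcases hv with rfl | rfl | hv
      · exact ⟨v, hyE₁, Or.inl rfl⟩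
      · exact ⟨v, hyE₂, Or.inl rfl⟩
      · exact (h.dominates v hv).mono hSTE) (by
      intro e he
      rcases hEL e he with rfl | rfl | heL
      · exact ⟨e, mem_insert_self _ _, by rfl⟩
      · exact ⟨y₁, mem_insert_self _ _,
          reachable_inside_of_eq_or_adj hyE₂ hyE₁ (Or.inr h12.symm)⟩
      · obtain ⟨s, hs, hes⟩ := reachable_cover hSTE h.dominates_right he (h.dominates e heL)
        exact ⟨s, mem_insert_of_mem hs, hes⟩) hconn
  have hyK₁ := hEK hyE₁
  have hyK₂ := hEK hyE₂
  have hKL : ∀ v ∈ K, v = y₁ ∨ v = y₂ ∨ v ∉ L := by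
    intro v hv
    have := hKW hv
    simpa only [mem_insert, mem_compl] using this
  have hYy : ∀ v ∈ Y₂, v ∉ Y₁ := fun v hv hv' => (disjoint_left.1 hY) hv' hv
  refine h.exists_isTwoKST (K := K) (Y := Y₁ ∪ Y₂) (Z := {y₁, y₂}) (y := y₁)
    (g := fun v => if v ∈ Y₁ then y₁ else y₂) hyK₁ hK
    (hSTE.trans hEK) (insert_subset hyK₁ (singleton_subset_iff.2 hyK₂))
    (insert_subset hy₁ (singleton_subset_iff.2 hy₂))
    ?_ ?_ (card_le_two) ?_ ?_ ?_ ?_ ?_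
  · intro v hv hvL
    simp only [mem_insert, mem_singleton]
    rcases hKL v hv with h | h | h
    · exact Or.inl h
    · exact Or.inr h
    · exact absurd hvL h
  · have h1 := card_insert_le y₁ S
    have h2 := card_union_le {y₁, y₂} ((S ∪ T) ∪ (Z₁ ∪ Z₂))
    have h3 := card_union_le (S ∪ T) (Z₁ ∪ Z₂)
    have h4 := h.card_left
    have h5 := card_union_le Z₁ Z₂
    rw [← hE] at h2
    omega
  · have := card_union_le Y₁ Y₂
    omega
  · intro v hv hvK
    exact ⟨y₁, hyK₁, hL v hv y₁ hy₁ fun hvy => hvK (hvy ▸ hyK₁)⟩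
  · intro v hv
    have hv' : v ∈ L ∧ v ≠ y₁ ∧ v ≠ y₂ := by
      rcases mem_union.1 hv with hv | hv
      · exact hY₁ v hv
      · exact hY₂ v hv
    refine ⟨fun hvK => ?_, ?_, ?_⟩
    · rcases hKL v hvK with h | h | h
      · exact hv'.2.1 h
      · exact hv'.2.2 h
      · exact h hv'.1
    · split_ifs
      · exact hyK₁
      · exact hyK₂
    · split_ifs
      · exact hL v hv'.1 y₁ hy₁ hv'.2.1
      · exact hL v hv'.1 y₂ hy₂ hv'.2.2
  · rw [← card_pair hne]
    exact card_le_card (insert_subset hyK₁ (singleton_subset_iff.2 hyK₂))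
  · intro p hp hpY z hz
    have hroot : ∀ v ∈ K, v ≠ y₁ → G.Adj y₁ v → p v = y₁ := by
      intro v hvK hvy hadj
      obtain ⟨h1, -, h3⟩ := hp v hvK hvy
      exact parent_eq_root (hK _ hyK₁ _ h1) ⟨hadj, hyK₁, hvK⟩ h3
    rcases mem_insert.1 hz with rfl | hz
    · simp only [if_true]
      have hsub : insert y₂ (Z₁ ∪ Y₁) ⊆ univ.filter fun v => v ≠ z ∧ p v = z := by
        intro v hv
        simp only [mem_filter, mem_univ, true_and]
        simp only [mem_insert, mem_union] at hv
        rcases hv with rfl | hv | hv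
        · exact ⟨hne.symm, hroot v hyK₂ hne.symm h12⟩
        · have hvz : v ≠ z := fun hvz => (hZ₁ v hv).1 (hvz ▸ hy₁)
          exact ⟨hvz, hroot v (hEK (hZE₁ hv)) hvz (hZ₁ v hv).2⟩
        · refine ⟨(hY₁ v hv).2.1, ?_⟩
          rw [hpY v (mem_union_left _ hv), if_pos hv]
      have h1 := card_le_card hsub
      have h2 : y₂ ∉ Z₁ ∪ Y₁ := by
        intro h'
        rcases mem_union.1 h' with h' | h'
        · exact (hZ₁ _ h').1 hy₂
        · exact (hY₁ _ h').2.2 rfl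
      have h3 : Disjoint Z₁ Y₁ := by
        rw [disjoint_left]
        intro v hv hv'
        exact (hZ₁ v hv).1 (hY₁ v hv').1
      rw [card_insert_of_notMem h2, card_union_of_disjoint h3] at h1
      omega
    · obtain rfl := mem_singleton.1 hz
      rw [if_neg hne.symm]
      have hsub : Z₂ ∪ Y₂ ⊆ univ.filter fun v => v ≠ y₁ ∧ p v = z := by
        intro v hv
        simp only [mem_filter, mem_univ, true_and]
        rcases mem_union.1 hv with hv | hv
        · obtain ⟨g1, g2, g3, g4⟩ := hZ₂ v hv
          have hvy : v ≠ y₁ := fun hvy => g1 (hvy ▸ hy₁)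
          refine ⟨hvy, ?_⟩
          have hvK := hEK (hZE₂ hv)
          obtain ⟨e1, e2, e3⟩ := hp v hvK hvy
          -- A vertex of `Z₂` is at distance 2 from the root `y₁`, and `y₂` is its only neighbour in
          -- `K` adjacent to `y₁`; so its parent must be `y₂`.
          have hdist : (inside G K).dist y₁ v ≤ 2 := by
            have hw1 : (inside G K).Adj y₁ z := ⟨h12, hyK₁, hyK₂⟩
            have hw2 : (inside G K).Adj z v := ⟨g2, hyK₂, hvK⟩
            exact SimpleGraph.dist_le (.cons hw1 (.cons hw2 .nil))
          have hpy : p v ≠ y₁ := fun hpy => g3 (hpy ▸ e2).symm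
          have hpos : (inside G K).dist y₁ (p v) ≠ 0 := by
            rw [Ne, (hK _ hyK₁ _ e1).dist_eq_zero_iff]
            exact hpy.symm
          have hone : (inside G K).dist y₁ (p v) = 1 := by omega
          rw [SimpleGraph.dist_eq_one_iff_adj] at hone
          rcases hKL _ e1 with h' | h' | h'
          · exact absurd h' hpy
          · exact h'
          · exact absurd e2 (g4 _ h' hone.1)
        · refine ⟨(hY₂ v hv).2.1, ?_⟩
          rw [hpY v (mem_union_right _ hv), if_neg (hYy v hv)]
      have h1 := card_le_card hsub
      have h3 : Disjoint Z₂ Y₂ := by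
        rw [disjoint_left]
        intro v hv hv'
        exact (hZ₂ v hv).1 (hY₂ v hv').1
      rw [card_union_of_disjoint h3] at h1
      omega

end IsCover

end TwoKST

/-! ### How `L` attaches to the components of `G - L` without a blocking set. -/

namespace TwoKST

open Finset
open scoped Classical

variable {V : Type*}

theorem isCutset_of_closed {G : SimpleGraph V} {U X : Set V} {a b : V} (ha : a ∉ U) (hb : b ∉ U)
    (haX : a ∈ X) (hbX : b ∉ X) (hX : ∀ v ∈ X, v ∉ U → ∀ w, w ∉ U → G.Adj v w → w ∈ X) :
    IsCutset G U := by
  intro h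
  obtain ⟨p⟩ := h ⟨a, ha⟩ ⟨b, hb⟩
  obtain ⟨d, -, h1, h2⟩ := p.exists_boundary_dart (Subtype.val ⁻¹' X) haX hbX
  exact h2 (hX _ h1 d.fst.2 _ d.snd.2 (by simpa using d.adj))

variable [Fintype V]

theorem isBlockingSet_iff {G : SimpleGraph V} {k : ℕ} {U : Set V} :
    IsBlockingSet G k U ↔
      IsCutset G U ∧ ∀ u ∈ U, 2 ≤ (nbr G univ u).card ∧ (nbr G univ u).card ≤ k := by
  simp only [IsBlockingSet, degree_eq_card_nbr]

theorem two_le_card_nbr {G : SimpleGraph V} {u a b : V} (ha : G.Adj u a) (hb : G.Adj u b)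
    (hab : a ≠ b) : 2 ≤ (nbr G univ u).card := by
  rw [← card_pair hab]
  exact card_le_card (insert_subset (mem_nbr.2 ⟨mem_univ _, ha⟩)
    (singleton_subset_iff.2 (mem_nbr.2 ⟨mem_univ _, hb⟩)))

/-- If no blocking set exists, every union `A` of components of `G - L` that misses some vertex of
`G - L` is adjacent to a vertex of `L` of degree at least `k + 1`. -/
theorem exists_attachment {G : SimpleGraph V} {k : ℕ} {L A : Finset V}
    (hno : ¬ ∃ U, IsBlockingSet G k U) (hAL : ∀ v ∈ A, v ∉ L)
    (hA : ∀ v ∈ A, ∀ w, w ∉ L → G.Adj v w → w ∈ A) {a b : V} (ha : a ∈ A) (hb : b ∉ A)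
    (hbL : b ∉ L) :
    ∃ y ∈ L, k + 1 ≤ (nbr G univ y).card ∧ (nbr G A y).Nonempty := by
  by_contra hcon
  push Not at hcon
  apply hno
  refine ⟨{u | u ∈ L ∧ 2 ≤ (nbr G univ u).card ∧ (nbr G univ u).card ≤ k},
    isBlockingSet_iff.2 ⟨?_, fun u hu => hu.2⟩⟩
  -- If the claim fails, vertices of `L` of degree above `k` miss `A`, and those of degree 1 that
  -- see `A` have no other neighbour. So `A` with these pendant vertices can only be left through
  -- `U`.
  refine isCutset_of_closed (a := a) (b := b)
    (X := {v | v ∈ A ∨ (v ∈ L ∧ (nbr G univ v).card < 2 ∧ ∃ a ∈ A, G.Adj v a)})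
    (fun h => hAL a ha h.1) (fun h => hbL h.1) (Or.inl ha) ?_ ?_
  · rintro (h | h)
    · exact hb h
    · exact hbL h.1
  · rintro v (hv | ⟨hvL, hv2, c, hc, hvc⟩) hvU w hwU hvw
    · by_cases hwL : w ∈ L
      · right
        refine ⟨hwL, ?_, v, hv, hvw.symm⟩
        by_contra hw2
        push Not at hw2
        have hwk : ¬ (nbr G univ w).card ≤ k := fun hwk => hwU ⟨hwL, hw2, hwk⟩
        have hmem : v ∈ nbr G A w := mem_nbr.2 ⟨hv, hvw.symm⟩
        have := hcon w hwL (by omega)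
        rw [this] at hmem
        exact notMem_empty _ hmem
      · exact Or.inl (hA v hv w hwL hvw)
    · left
      by_contra hwA
      have hne : c ≠ w := fun h => hwA (h ▸ hc)
      have := two_le_card_nbr hvc hvw hne
      omega

/-- By maximality, a bound on the neighbours of `y` in `A` holds for every vertex of `L` of degree
above `k`; the other vertices of `L` have at most `k` neighbours anyway. -/
theorem exists_max_attachment {G : SimpleGraph V} {k : ℕ} {L A : Finset V}
    (hno : ¬ ∃ U, IsBlockingSet G k U) (hAL : ∀ v ∈ A, v ∉ L)
    (hA : ∀ v ∈ A, ∀ w, w ∉ L → G.Adj v w → w ∈ A) {a b : V} (ha : a ∈ A) (hb : b ∉ A)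
    (hbL : b ∉ L) :
    ∃ y ∈ L, k + 1 ≤ (nbr G univ y).card ∧ (nbr G A y).Nonempty ∧
      ∀ l ∈ L, k + 1 ≤ (nbr G univ l).card → (nbr G A l).card ≤ (nbr G A y).card := by
  obtain ⟨y₀, hy₀, hdeg₀, hne₀⟩ := exists_attachment hno hAL hA ha hb hbL
  obtain ⟨y, hy, hmax⟩ := exists_max_image (L.filter fun l => k + 1 ≤ (nbr G univ l).card)
    (fun l => (nbr G A l).card) ⟨y₀, mem_filter.2 ⟨hy₀, hdeg₀⟩⟩
  obtain ⟨hyL, hydeg⟩ := mem_filter.1 hy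
  refine ⟨y, hyL, hydeg, ?_, fun l hl hdeg => hmax l (mem_filter.2 ⟨hl, hdeg⟩)⟩
  rw [← card_pos]
  exact (card_pos.2 hne₀).trans_le (hmax y₀ (mem_filter.2 ⟨hy₀, hdeg₀⟩))

/-- A large closed side `A` of `G - L` has a vertex whose neighbours all lie in `A`. -/
theorem exists_degree_lt_card {G : SimpleGraph V} {M : ℕ} {L A : Finset V}
    (hA : ∀ v ∈ A, ∀ w, w ∉ L → G.Adj v w → w ∈ A)
    (hLM : L.card ≤ M) (hM : ∀ l ∈ L, (nbr G A l).card ≤ M) (hAM : M * M < A.card) :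
    ∃ a ∈ A, (∀ l ∈ L, ¬ G.Adj l a) ∧ (nbr G univ a).card + 1 ≤ A.card := by
  have h1 : (L.biUnion fun l => nbr G A l).card < A.card := by
    refine (card_biUnion_le_card_mul _ _ _ hM).trans_lt (lt_of_le_of_lt ?_ hAM)
    exact Nat.mul_le_mul_right _ hLM
  obtain ⟨a, haA, ha⟩ := exists_mem_notMem_of_card_lt_card h1
  have hno : ∀ l ∈ L, ¬ G.Adj l a := fun l hl hadj =>
    ha (mem_biUnion.2 ⟨l, hl, mem_nbr.2 ⟨haA, hadj⟩⟩)
  refine ⟨a, haA, hno, ?_⟩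
  have h2 : nbr G univ a ⊆ A.erase a := by
    intro w hw
    have hadj := (mem_nbr.1 hw).2
    exact mem_erase.2 ⟨hadj.ne', hA a haA w (fun hwL => hno w hwL hadj.symm) hadj⟩
  have h3 := card_le_card h2
  rw [card_erase_of_mem haA] at h3
  have := card_pos.2 ⟨a, haA⟩
  omega

theorem card_nbr_le_of_forall {G : SimpleGraph V} {L A : Finset V} {y : V} (hy : y ∈ L)
    (h : ∀ v, v ∉ L → G.Adj y v → v ∈ A) :
    (nbr G univ y).card + 1 ≤ L.card + (nbr G A y).card := by
  have h1 : nbr G univ y ⊆ L.erase y ∪ nbr G A y := by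
    intro v hv
    have hadj := (mem_nbr.1 hv).2
    by_cases hvL : v ∈ L
    · exact mem_union_left _ (mem_erase.2 ⟨hadj.ne', hvL⟩)
    · exact mem_union_right _ (mem_nbr.2 ⟨h v hvL hadj, hadj⟩)
  have h2 := (card_le_card h1).trans (card_union_le _ _)
  rw [card_erase_of_mem hy] at h2
  have := card_pos.2 ⟨y, hy⟩
  omega

theorem card_nbr_mono {G : SimpleGraph V} (A : Finset V) (v : V) :
    (nbr G A v).card ≤ (nbr G univ v).card :=
  card_le_card (filter_subset_filter _ (subset_univ _))

namespace IsCover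

variable {G : SimpleGraph V} {k m r B₁ B₂ : ℕ} {L W S T : Finset V}

/-- Domination puts a vertex of `W` into the closed side `A`, and with it its closed neighbourhood
in `W`. -/
theorem lt_card_of_closed (h : IsCover G k m r B₁ B₂ L W S T) {A : Finset V} {M : ℕ}
    (hAL : ∀ v ∈ A, v ∉ L) (hA : ∀ v ∈ A, ∀ w, w ∉ L → G.Adj v w → w ∈ A)
    (hM : ∀ w ∈ W, M ≤ (nbr G W w).card) {a : V} (ha : a ∈ A) : M < A.card := by
  obtain ⟨w, hw, haw⟩ := h.dominates a (hAL a ha)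
  have hwW := h.union_subset hw
  have hwA : w ∈ A := by
    rcases haw with rfl | haw
    · exact ha
    · exact hA a ha w (h.notMem_of_mem w hwW) haw
  have h1 : insert w (nbr G W w) ⊆ A := by
    intro v hv
    rcases mem_insert.1 hv with rfl | hv
    · exact hwA
    · obtain ⟨hvW, hadj⟩ := mem_nbr.1 hv
      exact hA w hwA v (h.notMem_of_mem v hvW) hadj
  have h2 := card_le_card h1
  rw [card_insert_of_notMem fun h => G.loopless.irrefl _ (mem_nbr.1 h).2] at h2
  have := hM w hwW
  omega

/-- A vertex of `L` of degree above `k` that sees both components can be the root. Otherwise `y₁`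
sees only one component and `y₂` only the other; the edge `y₁y₂` joins them, and `2k` further
children are needed. -/
theorem exists_isTwoKST_of_not_reachable (h : IsCover G k m r B₁ B₂ L W S T) (hk : 1 ≤ k)
    (hL : ∀ a ∈ L, ∀ b ∈ L, a ≠ b → G.Adj a b)
    (hno : ¬ ∃ U, IsBlockingSet G k U)
    (hore : ∀ u v, u ≠ v → ¬ G.Adj u v →
      Fintype.card V + 2 * k ≤ 2 * ((nbr G univ u).card + (nbr G univ v).card) + 2)
    (hthree : ∀ a b c, a ∉ L → b ∉ L → c ∉ L → (inside G Lᶜ).Reachable a b ∨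
      (inside G Lᶜ).Reachable a c ∨ (inside G Lᶜ).Reachable b c)
    (hM : ∀ w ∈ W, (2 * k + 1) * (2 * k + 1) ≤ (nbr G W w).card)
    {a₀ b₀ : V} (ha₀ : a₀ ∉ L) (hb₀ : b₀ ∉ L) (hab : ¬ (inside G Lᶜ).Reachable a₀ b₀) :
    ∃ T, IsTwoKST G k T := by
  by_contra hcon
  set A := (Lᶜ).filter fun v => (inside G Lᶜ).Reachable a₀ v with hAdef
  set B := (Lᶜ).filter fun v => ¬ (inside G Lᶜ).Reachable a₀ v with hBdef
  have hmA : ∀ v, v ∈ A ↔ v ∉ L ∧ (inside G Lᶜ).Reachable a₀ v := by simp [hAdef]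
  have hmB : ∀ v, v ∈ B ↔ v ∉ L ∧ ¬ (inside G Lᶜ).Reachable a₀ v := by simp [hBdef]
  have hstep : ∀ v w, v ∉ L → w ∉ L → G.Adj v w → (inside G Lᶜ).Reachable v w :=
    fun v w hv hw hvw =>
      reachable_inside_of_eq_or_adj (mem_compl.2 hv) (mem_compl.2 hw) (Or.inr hvw)
  have hAL : ∀ v ∈ A, v ∉ L := fun v hv => ((hmA v).1 hv).1
  have hBL : ∀ v ∈ B, v ∉ L := fun v hv => ((hmB v).1 hv).1
  have hA : ∀ v ∈ A, ∀ w, w ∉ L → G.Adj v w → w ∈ A := fun v hv w hw hvw =>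
    (hmA w).2 ⟨hw, ((hmA v).1 hv).2.trans (hstep v w (hAL v hv) hw hvw)⟩
  have hB : ∀ v ∈ B, ∀ w, w ∉ L → G.Adj v w → w ∈ B := fun v hv w hw hvw =>
    (hmB w).2 ⟨hw, fun hr => ((hmB v).1 hv).2 (hr.trans (hstep v w (hBL v hv) hw hvw).symm)⟩
  have hAB : ∀ v, v ∉ L → v ∉ A → v ∈ B := fun v hv hvA =>
    (hmB v).2 ⟨hv, fun hr => hvA ((hmA v).2 ⟨hv, hr⟩)⟩
  have hABd : ∀ v ∈ A, v ∉ B := fun v hv hvB => ((hmB v).1 hvB).2 ((hmA v).1 hv).2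
  have hAr : ∀ a ∈ A, ∀ b ∈ A, (inside G Lᶜ).Reachable a b := fun a ha b hb =>
    ((hmA a).1 ha).2.symm.trans ((hmA b).1 hb).2
  have hBr : ∀ a ∈ B, ∀ b ∈ B, (inside G Lᶜ).Reachable a b := fun a ha b hb => by
    rcases hthree a₀ a b ha₀ (hBL a ha) (hBL b hb) with h' | h' | h'
    · exact absurd h' ((hmB a).1 ha).2
    · exact absurd h' ((hmB b).1 hb).2
    · exact h'
  have ha₀A : a₀ ∈ A := (hmA _).2 ⟨ha₀, by rfl⟩
  have hb₀B : b₀ ∈ B := (hmB _).2 ⟨hb₀, hab⟩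
  -- no vertex of `L` of large degree sees both sides
  have hnot : ∀ y ∈ L, k + 1 ≤ (nbr G univ y).card → ∀ a ∈ A, ∀ b ∈ B, G.Adj y a →
      ¬ G.Adj y b := by
    intro y hy hdeg a ha b hb hya hyb
    apply hcon
    refine h.exists_isTwoKST_of_root hL hy hdeg hk ?_ ⟨a₀, mem_compl.2 ha₀⟩
    have hm := inside_mono (G := G) (subset_insert y Lᶜ)
    have hy' : y ∈ insert y Lᶜ := mem_insert_self _ _
    have hall : ∀ v ∈ insert y Lᶜ, (inside G (insert y Lᶜ)).Reachable v y := by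
      intro v hv
      rcases mem_insert.1 hv with rfl | hv
      · rfl
      rw [mem_compl] at hv
      by_cases hvA : v ∈ A
      · exact ((hAr v hvA a ha).mono hm).trans (reachable_inside_of_eq_or_adj
          (mem_insert_of_mem (mem_compl.2 (hAL a ha))) hy' (Or.inr hya.symm))
      · exact ((hBr v (hAB v hv hvA) b hb).mono hm).trans (reachable_inside_of_eq_or_adj
          (mem_insert_of_mem (mem_compl.2 (hBL b hb))) hy' (Or.inr hyb.symm))
    exact fun u hu v hv => (hall u hu).trans (hall v hv).symm
  obtain ⟨y₁, hy₁, hdeg₁, ⟨a₁, ha₁⟩, hmax₁⟩ := exists_max_attachment hno hAL hA ha₀A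
    (fun hb => hABd b₀ hb hb₀B) hb₀
  obtain ⟨y₂, hy₂, hdeg₂, ⟨b₂, hb₂⟩, hmax₂⟩ := exists_max_attachment hno hBL hB hb₀B
    (hABd a₀ ha₀A) ha₀
  obtain ⟨ha₁A, hya₁⟩ := mem_nbr.1 ha₁
  obtain ⟨hb₂B, hyb₂⟩ := mem_nbr.1 hb₂
  have hne : y₁ ≠ y₂ := by
    rintro rfl
    exact hnot y₁ hy₁ hdeg₁ a₁ ha₁A b₂ hb₂B hya₁ hyb₂
  have hN₁ : ∀ v, v ∉ L → G.Adj y₁ v → v ∈ A := fun v hv hadj => by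
    by_contra hvA
    exact hnot y₁ hy₁ hdeg₁ a₁ ha₁A v (hAB v hv hvA) hya₁ hadj
  have hN₂ : ∀ v, v ∉ L → G.Adj y₂ v → v ∈ B := fun v hv hadj => by
    by_contra hvB
    have hvA : v ∈ A := by
      by_contra hvA
      exact hvB (hAB v hv hvA)
    exact hnot y₂ hy₂ hdeg₂ v hvA b₂ hb₂B hadj hyb₂
  have hD₁ := card_nbr_le_of_forall hy₁ hN₁
  have hD₂ := card_nbr_le_of_forall hy₂ hN₂
  have hcard : L.card + (A.card + B.card) = Fintype.card V := by
    rw [hAdef, hBdef, card_filter_add_card_filter_not, card_add_card_compl]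
  -- The degree-sum bound gives exactly this. If it failed, few vertices of `A` and `B` would see
  -- `L`, so some `a ∈ A`, `b ∈ B` have no neighbour in `L`. Adding the bounds for the pairs `y₁, b`
  -- and `y₂, a`, with `d(a) ≤ |A| - 1` and `d(b) ≤ |B| - 1`, yields a contradiction.
  have hsum : 2 * k + 2 ≤ L.card + (nbr G A y₁).card + (nbr G B y₂).card := by
    by_contra hlt
    have hL2 : L.card ≤ 2 * k + 1 := by omega
    obtain ⟨a, haA, hano, had⟩ := exists_degree_lt_card (M := 2 * k + 1) hA hL2 (fun l hl => by
      by_cases hl' : k + 1 ≤ (nbr G univ l).card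
      · have := hmax₁ l hl hl'
        omega
      · have := card_nbr_mono (G := G) A l
        omega) (h.lt_card_of_closed hAL hA hM ha₀A)
    obtain ⟨b, hbB, hbno, hbd⟩ := exists_degree_lt_card (M := 2 * k + 1) hB hL2 (fun l hl => by
      by_cases hl' : k + 1 ≤ (nbr G univ l).card
      · have := hmax₂ l hl hl'
        omega
      · have := card_nbr_mono (G := G) B l
        omega) (h.lt_card_of_closed hBL hB hM hb₀B)
    have h1 := hore y₁ b (fun e => hBL b hbB (e ▸ hy₁)) (hbno y₁ hy₁)
    have h2 := hore y₂ a (fun e => hAL a haA (e ▸ hy₂)) (hano y₂ hy₂)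
    omega
  obtain ⟨Z₁, hZ₁, hZ₁c⟩ := exists_subset_card_eq (min_le_right k (nbr G A y₁).card)
  obtain ⟨Z₂, hZ₂, hZ₂c⟩ := exists_subset_card_eq (min_le_right k (nbr G B y₂).card)
  set L' := (L.erase y₁).erase y₂ with hL'
  have hL'c : L'.card + 2 = L.card := by
    have h1 : y₂ ∈ L.erase y₁ := mem_erase.2 ⟨hne.symm, hy₂⟩
    have h2 := card_erase_add_one h1
    have h3 := card_erase_add_one hy₁
    rw [hL']
    omega
  have hmL' : ∀ v ∈ L', v ∈ L ∧ v ≠ y₁ ∧ v ≠ y₂ := by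
    intro v hv
    simp only [hL', mem_erase] at hv
    tauto
  -- Missing children come from the rest of `L`: `hdeg₁` or `hdeg₂` suffices if only one of `y₁`,
  -- `y₂` is short, `hsum` if both are.
  obtain ⟨Y₁, hY₁, hY₁c⟩ := exists_subset_card_eq (show k - Z₁.card ≤ L'.card by omega)
  have hrest : k - Z₂.card ≤ (L' \ Y₁).card := by
    rw [card_sdiff_of_subset hY₁]
    omega
  obtain ⟨Y₂, hY₂, hY₂c⟩ := exists_subset_card_eq hrest
  apply hcon
  refine h.exists_isTwoKST_of_pair hL hy₁ hy₂ hne (Z₁ := Z₁) (Z₂ := Z₂) (Y₁ := Y₁) (Y₂ := Y₂)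
    ?_ ?_ (fun v hv => hmL' v (hY₁ hv)) (fun v hv => hmL' v (mem_sdiff.1 (hY₂ hv)).1) ?_
    (by omega) (by omega) ?_
  · intro v hv
    obtain ⟨h1, h2⟩ := mem_nbr.1 (hZ₁ hv)
    exact ⟨hAL v h1, h2⟩
  · intro v hv
    obtain ⟨h1, h2⟩ := mem_nbr.1 (hZ₂ hv)
    refine ⟨hBL v h1, h2, fun h3 => hABd v (hN₁ v (hBL v h1) h3) h1, fun c hc hyc hvc => ?_⟩
    exact hABd c (hN₁ c hc hyc) (hB v h1 c hc hvc)
  · rw [disjoint_left]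
    intro v hv hv'
    exact (mem_sdiff.1 (hY₂ hv')).2 hv
  · set X := insert y₁ (insert y₂ Lᶜ) with hX
    have hLX : Lᶜ ⊆ X := (subset_insert _ _).trans (subset_insert _ _)
    have hm := inside_mono (G := G) hLX
    have hy₁X : y₁ ∈ X := mem_insert_self _ _
    have hy₂X : y₂ ∈ X := mem_insert_of_mem (mem_insert_self _ _)
    have h21 : (inside G X).Reachable y₂ y₁ :=
      reachable_inside_of_eq_or_adj hy₂X hy₁X (Or.inr (hL y₂ hy₂ y₁ hy₁ hne.symm))
    have hall : ∀ v ∈ X, (inside G X).Reachable v y₁ := by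
      intro v hv
      rcases mem_insert.1 hv with rfl | hv
      · rfl
      rcases mem_insert.1 hv with rfl | hv
      · exact h21
      rw [mem_compl] at hv
      by_cases hvA : v ∈ A
      · exact ((hAr v hvA a₁ ha₁A).mono hm).trans (reachable_inside_of_eq_or_adj
          (hLX (mem_compl.2 (hAL _ ha₁A))) hy₁X (Or.inr hya₁.symm))
      · exact (((hBr v (hAB v hv hvA) b₂ hb₂B).mono hm).trans (reachable_inside_of_eq_or_adj
          (hLX (mem_compl.2 (hBL _ hb₂B))) hy₂X (Or.inr hyb₂.symm))).trans h21
    exact fun u hu v hv => (hall u hu).trans (hall v hv).symm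

/-- The case in which the vertices of small degree form the clique `L`. -/
theorem exists_isTwoKST_of_not_isBlockingSet (h : IsCover G k m r B₁ B₂ L W S T) (hk : 1 ≤ k)
    (hL : ∀ a ∈ L, ∀ b ∈ L, a ≠ b → G.Adj a b) {x : V} (hx : x ∈ L)
    (hxW : ∀ w ∈ W, ¬ G.Adj x w) (hne : (Lᶜ).Nonempty)
    (hno : ¬ ∃ U, IsBlockingSet G k U)
    (hore : ∀ u v, u ≠ v → ¬ G.Adj u v →
      Fintype.card V + 2 * k ≤ 2 * ((nbr G univ u).card + (nbr G univ v).card) + 2)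
    (hthree : ∀ a b c, a ∉ L → b ∉ L → c ∉ L → (inside G Lᶜ).Reachable a b ∨
      (inside G Lᶜ).Reachable a c ∨ (inside G Lᶜ).Reachable b c)
    (hM : ∀ w ∈ W, (2 * k + 1) * (2 * k + 1) ≤ (nbr G W w).card) :
    ∃ T, IsTwoKST G k T := by
  by_cases hconn : ∀ a ∈ Lᶜ, ∀ b ∈ Lᶜ, (inside G Lᶜ).Reachable a b
  swap
  · push Not at hconn
    obtain ⟨a, ha, b, hb, hab⟩ := hconn
    exact h.exists_isTwoKST_of_not_reachable hk hL hno hore hthree hM (mem_compl.1 ha)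
      (mem_compl.1 hb) hab
  by_cases hbig : ∃ y ∈ L, k + 1 ≤ (nbr G univ y).card ∧ ∃ v, v ∉ L ∧ G.Adj y v
  · obtain ⟨y, hy, hdeg, v, hv, hyv⟩ := hbig
    refine h.exists_isTwoKST_of_root hL hy hdeg hk ?_ hne
    have hm := inside_mono (G := G) (subset_insert y Lᶜ)
    have hall : ∀ u ∈ insert y Lᶜ, (inside G (insert y Lᶜ)).Reachable u y := by
      intro u hu
      rcases mem_insert.1 hu with rfl | hu
      · rfl
      · exact ((hconn u hu v (mem_compl.2 hv)).mono hm).trans (reachable_inside_of_eq_or_adj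
          (mem_insert_of_mem (mem_compl.2 hv)) (mem_insert_self _ _) (Or.inr hyv.symm))
    exact fun u hu v hv => (hall u hu).trans (hall v hv).symm
  push Not at hbig
  have hnb : ∀ l ∈ L, ∃ v, v ∉ L ∧ G.Adj l v := by
    intro l hl
    by_contra hl'
    push Not at hl'
    apply hno
    obtain ⟨b, hb⟩ := hne
    rw [mem_compl] at hb
    -- These vertices separate `l` from the outside of `L`. Each is adjacent to `l` and to a vertex
    -- outside `L`, and `hbig` bounds its degree by `k`.
    refine ⟨{u | u ∈ L ∧ ∃ v, v ∉ L ∧ G.Adj u v}, isBlockingSet_iff.2 ⟨?_, ?_⟩⟩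
    · refine isCutset_of_closed (a := l) (b := b) (X := {v | v ∈ L})
        (fun ⟨_, v, hv, hlv⟩ => hl' v hv hlv) (fun hbU => hb hbU.1) hl hb ?_
      intro v hv hvU w _ hvw
      by_contra hw
      exact hvU ⟨hv, w, hw, hvw⟩
    · rintro u ⟨hu, v, hv, huv⟩
      constructor
      · have hul : u ≠ l := by
          rintro rfl
          exact hl' v hv huv
        exact two_le_card_nbr huv (hL u hu l hl hul) (fun e => hv (e ▸ hl))
      · by_contra hdeg
        exact hbig u hu (by omega) v hv huv
  have hLk : L.card ≤ k := by
    obtain ⟨v, hv, hxv⟩ := hnb x hx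
    have h1 : insert v (L.erase x) ⊆ nbr G univ x := by
      intro w hw
      rcases mem_insert.1 hw with rfl | hw
      · exact mem_nbr.2 ⟨mem_univ _, hxv⟩
      · obtain ⟨h2, h3⟩ := mem_erase.1 hw
        exact mem_nbr.2 ⟨mem_univ _, hL x hx w h3 h2.symm⟩
    have h2 := card_le_card h1
    rw [card_insert_of_notMem fun h' => hv (mem_erase.1 h').2] at h2
    have h3 := card_erase_add_one hx
    have h4 : ¬ k + 1 ≤ (nbr G univ x).card := fun hdeg => hbig x hx hdeg v hv hxv
    omega
  exact h.exists_isTwoKST_of_leaves hLk hx hxW hnb hconn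

end IsCover

end TwoKST

/-! ### Numerical bounds. -/

namespace TwoKST

open Finset
open scoped Classical

/-- With `k = j + 2`, this says `c(k + 1)(p/q)^(sk) ≤ 1`: raising `k` by one at least halves the
power and at most doubles `k + 1`. Hence `sk` greedy steps leave at most `n/(c(k + 1))` vertices. -/
theorem mul_pow_le_pow {p q c s : ℕ} (h₀ : c * 3 * p ^ (s * 2) ≤ q ^ (s * 2))
    (h₁ : 2 * p ^ s ≤ q ^ s) (j : ℕ) : c * (j + 3) * p ^ (s * (j + 2)) ≤ q ^ (s * (j + 2)) := by
  induction j with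
  | zero => simpa using h₀
  | succ j ih =>
    have e : s * (j + 1 + 2) = s * (j + 2) + s := by ring
    rw [e, pow_add, pow_add]
    calc c * (j + 1 + 3) * (p ^ (s * (j + 2)) * p ^ s)
        ≤ c * (2 * (j + 3)) * (p ^ (s * (j + 2)) * p ^ s) := by gcongr; omega
      _ = (c * (j + 3) * p ^ (s * (j + 2))) * (2 * p ^ s) := by ring
      _ ≤ q ^ (s * (j + 2)) * q ^ s := Nat.mul_le_mul ih h₁

theorem mul_div_le_of_mul_pow_le {a b e n : ℕ} (h : e * a ≤ b) (hb : 0 < b) :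
    e * (a * n / b) ≤ n := by
  have h1 := Nat.div_mul_le_self (a * n) b
  refine Nat.le_of_mul_le_mul_right ?_ hb
  calc e * (a * n / b) * b = e * (a * n / b * b) := by ring
    _ ≤ e * (a * n) := Nat.mul_le_mul_left _ h1
    _ = e * a * n := by ring
    _ ≤ b * n := Nat.mul_le_mul_right _ h
    _ = n * b := by ring

theorem mul_lt_mul_of_mul_le {a b n D : ℕ} (h : 8 * a ≤ b) (hb : 0 < b) (hD : 0 < D)
    (hn : n ≤ 7 * D) : a * n < D * b := by
  have h1 : 8 * (a * n) ≤ 7 * (D * b) := by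
    calc 8 * (a * n) = 8 * a * n := by ring
      _ ≤ b * (7 * D) := Nat.mul_le_mul h hn
      _ = 7 * (D * b) := by ring
  have := Nat.mul_pos hD hb
  omega

/-- The explicit form in which the bound `n ≥ n₁(k)` is used, with `k = j + 2`. -/
theorem le_of_n1_le {j n : ℕ} (hn : n1 (j + 2) ≤ n) :
    64 * j ^ 3 + 708 * j ^ 2 + 1686 * j + 1058 ≤ n := by
  have h := (isLeast_n1 (j + 2)).1.2 n hn
  have hj : (0 : ℝ) ≤ j := Nat.cast_nonneg j
  have hs0 := Real.sqrt_nonneg (n : ℝ)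
  have hs2 := Real.mul_self_sqrt (Nat.cast_nonneg (α := ℝ) n)
  have hc0 : 0 ≤ c (j + 2) := Real.sqrt_nonneg _
  push_cast at h
  have hroot : (2 : ℝ) ≤ √(2 * ((j : ℝ) + 2)) := Real.le_sqrt_of_sq_le (by nlinarith)
  have hc2 : ((j : ℝ) + 2) * (j + 1) * (j + 8) ≤ c (j + 2) * c (j + 2) := by
    unfold c
    push_cast
    rw [Real.mul_self_sqrt (by
      have : (0 : ℝ) ≤ (j : ℝ) + 2 - 1 := by linarith
      positivity)]
    have h1 : (0 : ℝ) ≤ ((j : ℝ) + 2) * (j + 1) := by positivity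
    have h2 := mul_le_mul_of_nonneg_left
      (show (j : ℝ) + 8 ≤ (j : ℝ) + 2 + 2 * √(2 * ((j : ℝ) + 2)) + 2 by linarith) h1
    calc _ ≤ _ := h2
      _ = _ := by ring
  set s := √(n : ℝ)
  set t := c (j + 2)
  have hA : 8 * t * s + (4 * (j : ℝ) ^ 2 + 22 * j + 34) ≤ s * s := by nlinarith
  have hspos : 0 < s := by
    rcases hs0.lt_or_eq with h' | h'
    · exact h'
    · rw [← h'] at hA
      nlinarith
  have hst : 8 * t ≤ s := by
    by_contra hlt
    push Not at hlt
    have := mul_lt_mul_of_pos_right hlt hspos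
    nlinarith
  -- Feeding `8 c_k ≤ √n` back into `hA` replaces `8 c_k √n` by `64 c_k²`, which is at least `64(j +
  -- 2)(j + 1)(j + 8)`.
  have h3 : 8 * t * (8 * t) ≤ 8 * t * s := mul_le_mul_of_nonneg_left hst (by positivity)
  have hfin : (64 * (j : ℝ) ^ 3 + 708 * j ^ 2 + 1686 * j + 1058) ≤ n := by nlinarith
  exact_mod_cast hfin

/-! ### The three ranges of the minimum degree. -/

variable {V : Type*} [Fintype V]

theorem card_far_add (G : SimpleGraph V) (x : V) :
    (far G x).card + (nbr G univ x).card + 1 = Fintype.card V := by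
  have h1 : (far G x)ᶜ = insert x (nbr G univ x) := by
    ext v
    simp only [mem_compl, mem_far, mem_insert, mem_nbr, mem_univ, true_and]
    tauto
  have h2 : x ∉ nbr G univ x := fun h => G.loopless.irrefl _ (mem_nbr.1 h).2
  have h3 := card_add_card_compl (far G x)
  rw [h1, card_insert_of_notMem h2] at h3
  omega

theorem card_nbr_le_card_nbr_far_add (G : SimpleGraph V) (x v : V) :
    (nbr G univ v).card ≤ (nbr G (far G x) v).card + (nbr G univ x).card := by
  have h2 : x ∉ nbr G univ x := fun h => G.loopless.irrefl _ (mem_nbr.1 h).2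
  -- The closed neighbourhood of `x` always contains a non-neighbour of `v`: `v` itself if it is
  -- adjacent to `x`, and `x` otherwise. This saves one in the count.
  have h1 : nbr G univ v ⊆ nbr G (far G x) v ∪ (insert x (nbr G univ x)).erase
      (if G.Adj x v then v else x) := by
    intro w hw
    have hvw := (mem_nbr.1 hw).2
    by_cases hwf : w ∈ far G x
    · exact mem_union_left _ (mem_nbr.2 ⟨hwf, hvw⟩)
    · refine mem_union_right _ (mem_erase.2 ⟨?_, ?_⟩)
      · split_ifs with h
        · exact hvw.ne'
        · rintro rfl
          exact h hvw.symm
      · rw [mem_far] at hwf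
        simp only [mem_insert, mem_nbr, mem_univ, true_and]
        tauto
  have hmem : (if G.Adj x v then v else x) ∈ insert x (nbr G univ x) := by
    split_ifs with h
    · exact mem_insert_of_mem (mem_nbr.2 ⟨mem_univ _, h⟩)
    · exact mem_insert_self _ _
  have h3 := (card_le_card h1).trans (card_union_le _ _)
  rw [card_erase_of_mem hmem, card_insert_of_notMem h2] at h3
  omega

theorem exists_isTwoKST_of_far_eq_empty {G : SimpleGraph V} {k : ℕ} {x : V}
    (hx : far G x = ∅) (hk : k + 2 ≤ Fintype.card V) : ∃ T, IsTwoKST G k T := by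
  have hadj : ∀ v, v ≠ x → G.Adj v x := by
    intro v hv
    by_contra h
    have : v ∈ far G x := mem_far.2 ⟨hv, fun h' => h h'.symm⟩
    rw [hx] at this
    exact notMem_empty _ this
  refine exists_isTwoKST_of_parent (fun _ => x) x (fun v => if v = x then 0 else 1) hadj
    (fun v hv => by simp [hv]) (fun z hz => Or.inl fun v _ h => hz h.symm) ?_
  have h1 : (univ.filter fun v => v ≠ x ∧ x = x) = univ.erase x := by
    ext v
    simp
  rw [h1, card_erase_of_mem (mem_univ _), card_univ]
  omega

/-- The case of minimum degree at least `n / 7`. -/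
theorem exists_isTwoKST_of_seventh_le {G : SimpleGraph V} (hG : G.Connected) {j : ℕ} {x : V}
    (hn : 64 * j ^ 3 + 708 * j ^ 2 + 1686 * j + 1058 ≤ Fintype.card V)
    (hmin : ∀ v, (nbr G univ x).card ≤ (nbr G univ v).card) (hW : (far G x).Nonempty)
    (hfar : ∀ w ∈ far G x, Fintype.card V + 2 * (j + 2) ≤
      2 * ((nbr G univ x).card + (nbr G univ w).card) + 2)
    (hd : Fintype.card V ≤ 7 * (nbr G univ x).card) : ∃ T, IsTwoKST G (j + 2) T := by
  set n := Fintype.card V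
  set d := (nbr G univ x).card
  have hdegq : ∀ w ∈ far G x, n ≤ 4 * (nbr G univ w).card := fun w hw => by
    have h1 := hfar w hw
    have h2 := hmin w
    omega
  -- With `m = 7k` and `e(k + 1)r ≤ n`, the last hypothesis gives `(k + 1)(3m + r + 1) ≤ d`. A
  -- smaller `d` needs a larger `e`, and permits it: `D`, about `n/2 - d`, grows and `p/q` can
  -- shrink.
  have key : ∀ p q e D : ℕ, 0 < q → e * 3 * p ^ (7 * 2) ≤ q ^ (7 * 2) → 2 * p ^ 7 ≤ q ^ 7 →
      8 ≤ e → (∀ w ∈ far G x, D ≤ (nbr G univ w).card) → q * n ≤ p * n + q * D →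
      n ≤ 7 * D → e * (21 * j ^ 2 + 106 * j + 129) + n ≤ e * d → ∃ T, IsTwoKST G (j + 2) T := by
    intro p q e D hq h0 h1 he hD hpq hnD hnum
    have hpow := mul_pow_le_pow h0 h1 j
    set a := p ^ (7 * (j + 2))
    set b := q ^ (7 * (j + 2))
    have hb : 0 < b := by positivity
    have hr := mul_div_le_of_mul_pow_le (n := n) hpow hb
    have h8 : 8 * a ≤ b := by
      refine le_trans (Nat.mul_le_mul_right _ ?_) hpow
      nlinarith
    refine exists_isTwoKST_of_minDegree hG (x := x) (d := d) (D := D) (p := p) (q := q)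
      (m := 7 * (j + 2)) (r := a * n / b) hmin hW hD hpq
      (mul_lt_mul_of_mul_le h8 hb (by omega) hnD)
      (fun t ht => (Nat.le_div_iff_mul_le hb).2 ht) ?_
    set r := a * n / b
    refine Nat.le_of_mul_le_mul_left ?_ (show 0 < e by omega)
    calc e * ((j + 2) * (3 * (7 * (j + 2)) + r + 1) + (3 * (7 * (j + 2)) + r + 1))
        = e * (21 * j ^ 2 + 106 * j + 129) + e * (j + 3) * r := by ring
      _ ≤ e * d := by omega
  rcases Nat.lt_or_ge (5 * d) n with h5 | h5
  · have hD : ∀ w ∈ far G x, (n + 1) / 2 + j + 1 - d ≤ (nbr G univ w).card := fun w hw => by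
      have := hfar w hw
      omega
    rcases Nat.lt_or_ge (6 * d) n with h6 | h6
    · exact key 2 3 90 _ (by norm_num) (by norm_num) (by norm_num) (by norm_num) hD
        (by omega) (by omega) (by omega)
    · exact key 7 10 40 _ (by norm_num) (by norm_num) (by norm_num) (by norm_num) hD
        (by omega) (by omega) (by omega)
  · exact key 3 4 18 ((n + 3) / 4) (by norm_num) (by norm_num) (by norm_num) (by norm_num)
      (fun w hw => by have := hdegq w hw; omega) (by omega) (by omega) (by omega)

/-- The case of minimum degree between `n / 10` and `n / 7`. -/
theorem exists_isTwoKST_of_tenth_le {G : SimpleGraph V} (hG : G.Connected) {j : ℕ} {x : V}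
    (hn : 64 * j ^ 3 + 708 * j ^ 2 + 1686 * j + 1058 ≤ Fintype.card V)
    (hmin : ∀ v, (nbr G univ x).card ≤ (nbr G univ v).card) (hW : (far G x).Nonempty)
    (hfar : ∀ w ∈ far G x, Fintype.card V + 2 * (j + 2) ≤
      2 * ((nbr G univ x).card + (nbr G univ w).card) + 2)
    (hd : Fintype.card V ≤ 10 * (nbr G univ x).card)
    (hd7 : 7 * (nbr G univ x).card < Fintype.card V) : ∃ T, IsTwoKST G (j + 2) T := by
  have hcard := card_far_add G x
  set n := Fintype.card V
  set d := (nbr G univ x).card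
  set W := far G x
  set B := (n + 1) / 2 + j + 1 - d with hBdef
  have hB : ∀ w ∈ W, B ≤ (nbr G univ w).card := fun w hw => by
    have := hfar w hw
    omega
  have hD : ∀ w ∈ W, B - d ≤ (nbr G W w).card := fun w hw => by
    have h1 := card_nbr_le_card_nbr_far_add G x w
    have h2 := hB w hw
    change (nbr G univ w).card ≤ (nbr G W w).card + d at h1
    omega
  have hpow := mul_pow_le_pow (p := 3) (q := 4) (c := 18) (s := 7) (by norm_num) (by norm_num) j
  set a := 3 ^ (7 * (j + 2))
  set b := 4 ^ (7 * (j + 2))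
  have hb : 0 < b := by positivity
  have hr := mul_div_le_of_mul_pow_le (n := W.card) hpow hb
  have h8 : 8 * a ≤ b := by
    refine le_trans (Nat.mul_le_mul_right _ ?_) hpow
    omega
  have hr3 : 54 * (a * W.card / b) ≤ W.card := by
    refine le_trans (Nat.mul_le_mul_right _ ?_) hr
    omega
  -- Up to lower-order terms `n - d < 4(n/2 - 2d)`, which is `7d < n`.
  have hW4 : W.card < 4 * (B - d + 1) := by omega
  have hpq : 4 * W.card ≤ 3 * W.card + 4 * (B - d) := by omega
  have hW7 : W.card ≤ 7 * (B - d) := by omega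
  refine exists_isTwoKST_of_far hG (x := x) (d := d) (B := B) (D := B - d) (p := 3) (q := 4)
    (m := 7 * (j + 2)) (r := a * W.card / b) hmin hW hB hD hW4 hpq
    (mul_lt_mul_of_mul_le h8 hb (by omega) hW7)
    (fun t ht => (Nat.le_div_iff_mul_le hb).2 ht) ?_ ?_
  · set r := a * W.card / b
    have e : (j + 2) * (3 * (7 * (j + 2)) + r + 1) + (3 * (7 * (j + 2)) + r + 1) =
        21 * j ^ 2 + 106 * j + 129 + (j + 3) * r := by ring
    have e' : 18 * (j + 3) * r = 18 * ((j + 3) * r) := by ring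
    rw [e]
    omega
  · omega

/-- The case of minimum degree less than `n / 10`. -/
theorem exists_isTwoKST_of_lt_tenth {G : SimpleGraph V} {j : ℕ} {x : V}
    (hn : 64 * j ^ 3 + 708 * j ^ 2 + 1686 * j + 1058 ≤ Fintype.card V)
    (hno : ¬ ∃ U, IsBlockingSet G (j + 2) U)
    (hore : ∀ u v, u ≠ v → ¬ G.Adj u v →
      Fintype.card V + 2 * (j + 2) ≤ 2 * ((nbr G univ u).card + (nbr G univ v).card) + 2)
    (hd : 10 * (nbr G univ x).card < Fintype.card V) : ∃ T, IsTwoKST G (j + 2) T := by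
  have hcard := card_far_add G x
  set n := Fintype.card V with hndef
  set d := (nbr G univ x).card with hddef
  set W := far G x with hWdef
  have hfar : ∀ w ∈ W, n + 2 * (j + 2) ≤ 2 * (d + (nbr G univ w).card) + 2 := fun w hw =>
    hore x w (mem_far.1 hw).1.symm (mem_far.1 hw).2
  set B := (n + 1) / 2 + j + 1 - d with hBdef
  have hB : ∀ w ∈ W, B ≤ (nbr G univ w).card := fun w hw => by
    have := hfar w hw
    omega
  have hfarle : ∀ v, (nbr G univ v).card ≤ (nbr G W v).card + d :=
    card_nbr_le_card_nbr_far_add G x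
  have hD : ∀ w ∈ W, B - d ≤ (nbr G W w).card := fun w hw => by
    have h1 := hfarle w
    have h2 := hB w hw
    omega
  -- The threshold is half the degree-sum bound, so two vertices below it must be adjacent.
  set L := univ.filter fun v => 4 * (nbr G univ v).card + 2 < n + 2 * (j + 2) with hLdef
  have hmL : ∀ v, v ∈ L ↔ 4 * (nbr G univ v).card + 2 < n + 2 * (j + 2) := by simp [hLdef]
  have hL : ∀ a ∈ L, ∀ b ∈ L, a ≠ b → G.Adj a b := by
    intro a ha b hb hab
    by_contra h
    have h1 := hore a b hab h
    rw [hmL] at ha hb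
    omega
  have hx : x ∈ L := by
    rw [hmL]
    omega
  have hWL : ∀ w ∈ W, w ∉ L := by
    intro w hw hwL
    have h1 := hB w hw
    rw [hmL] at hwL
    omega
  have hWne : W.Nonempty := by
    rw [← card_pos]
    omega
  have hLne : (Lᶜ).Nonempty := by
    obtain ⟨w, hw⟩ := hWne
    exact ⟨w, mem_compl.2 (hWL w hw)⟩
  set B₁ := (n + 2 * j + 5) / 4 with hB₁def
  have hB₁ : ∀ v, v ∉ L → B₁ ≤ (nbr G univ v).card := by
    intro v hv
    rw [hmL] at hv
    omega
  have hD₁ : ∀ v, v ∉ L → B₁ - d ≤ (nbr G W v).card := fun v hv => by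
    have h1 := hfarle v
    have h2 := hB₁ v hv
    omega
  -- The ratio 5/6 fits since `|W| ≤ 6(B₁ - d)`, roughly `n - d ≤ 6(n/4 - d)`, follows from `10d <
  -- n`.
  have hpow := mul_pow_le_pow (p := 5) (q := 6) (c := 6) (s := 8) (by norm_num) (by norm_num) j
  set a := 5 ^ (8 * (j + 2))
  set b := 6 ^ (8 * (j + 2))
  have hb : 0 < b := by positivity
  have hr := mul_div_le_of_mul_pow_le (n := n) hpow hb
  have h8 : 8 * a ≤ b := by
    refine le_trans (Nat.mul_le_mul_right _ ?_) hpow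
    omega
  have hr3 : 18 * (a * n / b) ≤ n := by
    refine le_trans (Nat.mul_le_mul_right _ ?_) hr
    omega
  have hLn : (Lᶜ).card ≤ n := card_le_univ _
  obtain ⟨S, hSW, T, hTW, hSm, hTr, hdom, hT⟩ := exists_cover (G := G) (P := W)
    (A := Lᶜ) (S₀ := ∅) (D := B₁ - d) (p := 5) (q := 6) (m := 8 * (j + 2)) hWne
    (fun v hv => hD₁ v (mem_compl.1 hv)) (by omega)
    (fun v hv => Or.inl (mem_compl.2 (hWL v hv)))
    (mul_lt_mul_of_mul_le h8 hb (by omega) (by omega))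
  rw [union_empty] at hT
  have hcover : IsCover G (j + 2) (8 * (j + 2)) (a * n / b) B₁ B L W S T :=
    { notMem_of_mem := hWL
      left_subset := hSW
      right_subset := hTW
      card_left := hSm
      card_right := (Nat.le_div_iff_mul_le hb).2 (hTr.trans (Nat.mul_le_mul_left _ hLn))
      dominates := fun h hh => hdom h (mem_compl.2 hh)
      dominates_right := hT
      le_degree := hB₁
      le_degree_of_mem := hB
      rich := by
        set r := a * n / b
        have e : (j + 2) * (3 * (8 * (j + 2)) + r + 2 * (j + 2) + 2) +
            (3 * (8 * (j + 2)) + r + 2 * (j + 2) + 2) + 2 * (j + 2) =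
            26 * j ^ 2 + 134 * j + 166 + (j + 3) * r := by ring
        have e' : 6 * (j + 3) * r = 6 * ((j + 3) * r) := by ring
        rw [e]
        omega
      poor := by
        set r := a * n / b
        have e : (j + 2) * (2 * (8 * (j + 2)) + 2 * (j + 2)) +
            (3 * (8 * (j + 2)) + r + 2 * (j + 2) + 2) + 2 * (j + 2) =
            18 * j ^ 2 + 100 * j + 130 + r := by ring
        rw [e]
        omega }
  refine hcover.exists_isTwoKST_of_not_isBlockingSet (by omega) hL hx
    (fun w hw => (mem_far.1 hw).2) hLne hno hore ?_ ?_
  -- Every component of `G - L` meets `W`, and three components would need about `3(n/2 - 2d) ≤ n -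
  -- d`, contrary to `10d < n`.
  · intro u v w hu hv hw
    by_contra hcon
    push Not at hcon
    have hW' : ∀ y, y ∉ L → ∃ z ∈ W, (inside G Lᶜ).Reachable y z := by
      intro y hy
      have h1 := hD₁ y hy
      obtain ⟨z, hz⟩ := card_pos.1 (show 0 < (nbr G W y).card by omega)
      obtain ⟨hzW, hyz⟩ := mem_nbr.1 hz
      exact ⟨z, hzW, reachable_inside_of_eq_or_adj (mem_compl.2 hy)
        (mem_compl.2 (hWL z hzW)) (Or.inr hyz)⟩
    obtain ⟨u', hu', huu⟩ := hW' u hu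
    obtain ⟨v', hv', hvv⟩ := hW' v hv
    obtain ⟨w', hw', hww⟩ := hW' w hw
    have huv : ¬ (inside G Lᶜ).Reachable u' v' := fun h => hcon.1 ((huu.trans h).trans hvv.symm)
    have huw : ¬ (inside G Lᶜ).Reachable u' w' := fun h => hcon.2.1 ((huu.trans h).trans hww.symm)
    have hvw : ¬ (inside G Lᶜ).Reachable v' w' := fun h => hcon.2.2 ((hvv.trans h).trans hww.symm)
    have h1 : u' ≠ v' := by rintro rfl; exact huv (by rfl)
    have h2 : u' ≠ w' := by rintro rfl; exact huw (by rfl)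
    have h3 : v' ≠ w' := by rintro rfl; exact hvw (by rfl)
    have hm : inside G W ≤ inside G Lᶜ := inside_mono fun z hz => mem_compl.2 (hWL z hz)
    have h4 := card_mul_le_of_not_reachable (G := G) (W := W) (S := {u', v', w'}) (by
      intro z hz
      simp only [mem_insert, mem_singleton] at hz
      rcases hz with rfl | rfl | rfl <;> assumption) (by
      intro s hs t ht hst
      have hst' := hst.mono hm
      simp only [mem_insert, mem_singleton] at hs ht
      rcases hs with rfl | rfl | rfl <;> rcases ht with rfl | rfl | rfl
      · rfl
      · exact absurd hst' huv
      · exact absurd hst' huw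
      · exact absurd hst'.symm huv
      · rfl
      · exact absurd hst' hvw
      · exact absurd hst'.symm huw
      · exact absurd hst'.symm hvw
      · rfl) hD
    rw [card_eq_three.2 ⟨u', v', w', h1, h2, h3, rfl⟩] at h4
    omega
  · intro w hw
    have h1 := hD w hw
    have e : (2 * (j + 2) + 1) * (2 * (j + 2) + 1) = 4 * j ^ 2 + 20 * j + 25 := by ring
    rw [e]
    omega

theorem exists_isTwoKST_of_ore {G : SimpleGraph V} (hG : G.Connected) {j : ℕ}
    (hn : 64 * j ^ 3 + 708 * j ^ 2 + 1686 * j + 1058 ≤ Fintype.card V)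
    (hno : ¬ ∃ U, IsBlockingSet G (j + 2) U)
    (hore : ∀ u v, u ≠ v → ¬ G.Adj u v →
      Fintype.card V + 2 * (j + 2) ≤ 2 * ((nbr G univ u).card + (nbr G univ v).card) + 2) :
    ∃ T, IsTwoKST G (j + 2) T := by
  have := hG.nonempty
  obtain ⟨x, -, hmin⟩ := exists_min_image univ (fun v => (nbr G univ v).card) univ_nonempty
  replace hmin : ∀ v, (nbr G univ x).card ≤ (nbr G univ v).card := fun v => hmin v (mem_univ v)
  rcases (far G x).eq_empty_or_nonempty with hW | hW
  · exact exists_isTwoKST_of_far_eq_empty hW (by omega)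
  have hfar : ∀ w ∈ far G x, Fintype.card V + 2 * (j + 2) ≤
      2 * ((nbr G univ x).card + (nbr G univ w).card) + 2 := fun w hw =>
    hore x w (mem_far.1 hw).1.symm (mem_far.1 hw).2
  rcases Nat.lt_or_ge (10 * (nbr G univ x).card) (Fintype.card V) with h10 | h10
  · exact exists_isTwoKST_of_lt_tenth hn hno hore h10
  rcases Nat.lt_or_ge (7 * (nbr G univ x).card) (Fintype.card V) with h7 | h7
  · exact exists_isTwoKST_of_tenth_le hG hn hmin hW hfar h10 h7
  · exact exists_isTwoKST_of_seventh_le hG hn hmin hW hfar h7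

theorem ore_of_sigma2 {G : SimpleGraph V} {k n : ℕ}
    (hσ : ENNReal.ofReal (((n : ℝ) + 2 * (k : ℝ) - 2) / 2) ≤ (sigma2 G : ENNReal))
    {u v : V} (huv : u ≠ v) (hadj : ¬ G.Adj u v) :
    n + 2 * k ≤ 2 * ((nbr G univ u).card + (nbr G univ v).card) + 2 := by
  have h1 : sigma2 G ≤ ((G.degree u + G.degree v : ℕ) : ℕ∞) :=
    (iInf_le _ u).trans ((iInf_le _ v).trans (iInf_le _ ⟨huv, hadj⟩))
  have h2 : ENNReal.ofReal (((n : ℝ) + 2 * (k : ℝ) - 2) / 2) ≤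
      ((G.degree u + G.degree v : ℕ) : ENNReal) := by
    refine hσ.trans ((ENat.toENNReal_le.2 h1).trans (le_of_eq ?_))
    simp
  rw [ENNReal.ofReal_le_natCast] at h2
  have h3 : (n : ℝ) + 2 * k ≤ 2 * ((G.degree u + G.degree v : ℕ) : ℝ) + 2 := by linarith
  rw [degree_eq_card_nbr, degree_eq_card_nbr] at h3
  exact_mod_cast h3

end TwoKST

theorem theorem3 {V : Type*} [Fintype V] (k : ℕ) (hk : 2 ≤ k) (G : SimpleGraph V)
    (hG : G.Connected) (n : ℕ) (hcard : Fintype.card V = n) (hn : TwoKST.n1 k ≤ n)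
    (hσ : ENNReal.ofReal (((n : ℝ) + 2 * (k : ℝ) - 2) / 2) ≤ (TwoKST.sigma2 G : ENNReal)) :
    (∃ T : SimpleGraph V, TwoKST.IsTwoKST G k T) ↔
      ¬ ∃ U : Set V, TwoKST.IsBlockingSet G k U := by
  constructor
  · rintro ⟨T, hT⟩ ⟨U, hU⟩
    exact hT.not_isBlockingSet U hU
  · intro hno
    obtain ⟨j, rfl⟩ : ∃ j, k = j + 2 := ⟨k - 2, by omega⟩
    subst hcard
    exact TwoKST.exists_isTwoKST_of_ore hG (TwoKST.le_of_n1_le hn) hno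
      fun u v huv hadj => TwoKST.ore_of_sigma2 hσ huv hadj
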